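/- Let $\ell\ge 1$ be an integer and let $\mathfrak g_\ell$ be the Lie algebra over $\mathbb K\in\{\mathbb R,\mathbb C\}$ with basis $D,H,C,P_0,\dots,P_{2\ell}$ and nonzero brackets $[D,H]=H$, $[D,C]=-C$, $[C,H]=2D$, $[H,P_n]=-nP_{n-1}$, $[D,P_n]=(\ell-n)P_n$, $[C,P_n]=(2\ell-n)P_{n+1}$. Let $G$ be the group generated by the exponentials $\exp(\operatorname{ad}X)$, $X\in\mathfrak g_\ell$; write $e^X\in G$ for the exponential of $X$. Let $G_+=\{e^{tH}e^{\sum_{n<\ell}x_nP_n}\}$ with coordinates $(t,x_0,\dots,x_{\ell-1})$, $G_0=\{e^{aD+bP_\ell}\}$, and let $G_-$ be the subgroup generated by the exponentials of the elements of $\mathfrak g_\ell^-=\langle C,P_{\ell+1},\dots,P_{2\ell}\rangle$. For $\delta,p\in\mathbb C$ and an open set $\Omega\subseteq G$ with $\Omega G_0G_-\subseteq\Omega$ (for instance $\Omega=G$), let $C_{\delta,p}(\Omega)$ be the space of smooth (holomorphic if $\mathbb K=\mathbb C$) functions $f:\Omega\to\mathbb C$ with $f(g\,e^{aD+bP_\ell}\,y)=e^{a\delta+bp}f(g)$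 for $g\in\Omega$, $a,b\in\mathbb K$, $y\in G_-$. Put $(T(g)f)(g')=f(g^{-1}g')$, so that $T(g)$ maps $C_{\delta,p}(\Omega)$ to $C_{\delta,p}(g\Omega)$, and $(\pi_R(X)f)(g)=\frac{d}{d\tau}f(ge^{\tau X})|_{\tau=0}$. For $n\ge1$ with $2n\le \ell+1$ put $$\tilde{\mathcal S}^{(2n)}(y_0,\dots,y_{\ell-1})=\sum_{j=1}^{n-1}\frac{(-1)^{n+j}\,2\,((\ell+n)!)^2}{(\ell+j)!\,(\ell+2n-j)!}\,y_{\ell-2n+j}\,y_{\ell-j}+y_{\ell-n}^2 .$$ Let $p=0$, $\delta\in\mathbb C$, $k\ge1$. Then the equations $$\Big(\frac{\partial}{\partial x_{\ell-1}}\Big)^k\psi=0,\qquad \Big(\tilde{\mathcal S}^{(2n)}\big(\tfrac{\partial}{\partial x}\big)\Big)^k\psi=0,\qquad \Big(\frac{\partial}{\partial x_{\ell-1}}\Big)^k\Big(\tilde{\mathcal S}^{(2n)}\big(\tfrac{\partial}{\partial x}\big)\Big)^k\psi=0$$ are invariant under $G$ in the following sense, with $\mathcal P(y)=y_{\ell-1}^k$,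 $\tilde{\mathcal S}^{(2n)}(y)^k$, $y_{\ell-1}^k\tilde{\mathcal S}^{(2n)}(y)^k$ and $\delta'=\delta+k$, $\delta+2nk$, $\delta+(2n+1)k$, respectively. Let $\pi_R(\mathcal P)$ be the operator obtained by substituting $\pi_R(P_m)$ for $y_m$. For all $\Omega$ as above: (i) on $G_+\cap\Omega$, in the coordinates $(t,x)$, $\pi_R(\mathcal P)f$ is $\mathcal P(\partial/\partial x)$ applied to $f|_{G_+}$, for $f\in C_{\delta,0}(\Omega)$; (ii) $\pi_R(\mathcal P)$ maps $C_{\delta,0}(\Omega)$ to $C_{\delta',0}(\Omega)$; (iii) $\pi_R(\mathcal P)T(g)f=T(g)\pi_R(\mathcal P)f$ on $g\Omega$ for all $g\in G$ and $f\in C_{\delta,0}(\Omega)$; (iv) if $\Omega\subseteq G_+G_0G_-$, $f\in C_{\delta,0}(\Omega)$ and $\psi=f|_{G_+}$ satisfies $\mathcal P(\partial/\partial x)\psi=0$ on $G_+\cap\Omega$, then for every $g\in G$ the function $\psi'=(T(g)f)|_{G_+}$ satisfies $\mathcal P(\partial/\partial x)\psi'=0$ on $G_+\cap g\Omega$. 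-/

import Mathlib

open scoped ContDiff

noncomputable section

/-! ## The Lie algebra `𝔤_ℓ` -/

/-- The underlying space of the `d = 1` conformal Galilei algebra `𝔤_ℓ` over `𝕜`; the element
`(d, h, c, p)` stands for `d D + h H + c C + ∑ n, p n • P_n`, `0 ≤ n ≤ 2ℓ`. -/
def CGA (𝕜 : Type*) (ℓ : ℕ) : Type _ := 𝕜 × 𝕜 × 𝕜 × (Fin (2 * ℓ + 1) → 𝕜)

namespace CGA

variable {𝕜 : Type*} [RCLike 𝕜] {ℓ : ℕ}

instance : NormedAddCommGroup (CGA 𝕜 ℓ) :=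
  inferInstanceAs (NormedAddCommGroup (𝕜 × 𝕜 × 𝕜 × (Fin (2 * ℓ + 1) → 𝕜)))

instance : NormedSpace 𝕜 (CGA 𝕜 ℓ) :=
  inferInstanceAs (NormedSpace 𝕜 (𝕜 × 𝕜 × 𝕜 × (Fin (2 * ℓ + 1) → 𝕜)))

instance : FiniteDimensional 𝕜 (CGA 𝕜 ℓ) :=
  inferInstanceAs (FiniteDimensional 𝕜 (𝕜 × 𝕜 × 𝕜 × (Fin (2 * ℓ + 1) → 𝕜)))

instance : CompleteSpace (CGA 𝕜 ℓ) := FiniteDimensional.complete 𝕜 (CGA 𝕜 ℓ)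

/-- The coordinate of `D`. -/
def cD (X : CGA 𝕜 ℓ) : 𝕜 := X.1

/-- The coordinate of `H`. -/
def cH (X : CGA 𝕜 ℓ) : 𝕜 := X.2.1

/-- The coordinate of `C`. -/
def cC (X : CGA 𝕜 ℓ) : 𝕜 := X.2.2.1

/-- The coordinate of `P_n`, extended by `0` to all natural numbers `n`. -/
def cP (X : CGA 𝕜 ℓ) (n : ℕ) : 𝕜 := if h : n < 2 * ℓ + 1 then X.2.2.2 ⟨n, h⟩ else 0

/-- The element with the given coordinates. -/
def mk (d h c : 𝕜) (p : ℕ → 𝕜) : CGA 𝕜 ℓ := (d, h, c, fun n => p n)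

/-- The `P_n`-coordinate of `[d D + h H + c C, ∑ m, Y.cP m • P_m]` for `X = (d, h, c, _)`, from
`[D, P_n] = (ℓ - n) P_n`, `[H, P_n] = -n P_{n-1}`, `[C, P_n] = (2ℓ - n) P_{n+1}`. -/
def actP (X Y : CGA 𝕜 ℓ) : ℕ → 𝕜
  | 0 => X.cD * ℓ * Y.cP 0 - X.cH * Y.cP 1
  | n + 1 => X.cD * (ℓ - (n + 1)) * Y.cP (n + 1) - X.cH * (n + 2) * Y.cP (n + 2)
      + X.cC * (2 * ℓ - n) * Y.cP n

/-- The Lie bracket given by `[D, H] = H`, `[D, C] = -C`, `[C, H] = 2 D`,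
`[H, P_n] = -n P_{n-1}`, `[D, P_n] = (ℓ - n) P_n`, `[C, P_n] = (2ℓ - n) P_{n+1}`,
all other brackets of basis elements (up to antisymmetry) being zero. -/
instance : Bracket (CGA 𝕜 ℓ) (CGA 𝕜 ℓ) where
  bracket X Y := mk
    (2 * (X.cC * Y.cH - X.cH * Y.cC))
    (X.cD * Y.cH - X.cH * Y.cD)
    (X.cC * Y.cD - X.cD * Y.cC)
    (fun n => actP X Y n - actP Y X n)

@[ext]
theorem ext {X Y : CGA 𝕜 ℓ} (hD : X.cD = Y.cD) (hH : X.cH = Y.cH) (hC : X.cC = Y.cC)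
    (hP : ∀ n, n < 2 * ℓ + 1 → X.cP n = Y.cP n) : X = Y := by
  refine Prod.ext hD (Prod.ext hH (Prod.ext hC ?_))
  funext n
  have := hP n n.2
  simpa [cP, n.2] using this

@[simp] theorem cD_add (X Y : CGA 𝕜 ℓ) : (X + Y).cD = X.cD + Y.cD := rfl
@[simp] theorem cH_add (X Y : CGA 𝕜 ℓ) : (X + Y).cH = X.cH + Y.cH := rfl
@[simp] theorem cC_add (X Y : CGA 𝕜 ℓ) : (X + Y).cC = X.cC + Y.cC := rfl
@[simp] theorem cP_add (X Y : CGA 𝕜 ℓ) (n : ℕ) : (X + Y).cP n = X.cP n + Y.cP n := by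
  unfold cP
  split_ifs
  · rfl
  · simp
@[simp] theorem cD_zero : (0 : CGA 𝕜 ℓ).cD = 0 := rfl
@[simp] theorem cH_zero : (0 : CGA 𝕜 ℓ).cH = 0 := rfl
@[simp] theorem cC_zero : (0 : CGA 𝕜 ℓ).cC = 0 := rfl
@[simp] theorem cP_zero (n : ℕ) : (0 : CGA 𝕜 ℓ).cP n = 0 := by
  unfold cP
  split_ifs
  · rfl
  · rfl
@[simp] theorem cD_smul (a : 𝕜) (X : CGA 𝕜 ℓ) : (a • X).cD = a * X.cD := rfl
@[simp] theorem cH_smul (a : 𝕜) (X : CGA 𝕜 ℓ) : (a • X).cH = a * X.cH := rfl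
@[simp] theorem cC_smul (a : 𝕜) (X : CGA 𝕜 ℓ) : (a • X).cC = a * X.cC := rfl
@[simp] theorem cP_smul (a : 𝕜) (X : CGA 𝕜 ℓ) (n : ℕ) : (a • X).cP n = a * X.cP n := by
  unfold cP
  split_ifs
  · rfl
  · simp
@[simp] theorem cD_lie (X Y : CGA 𝕜 ℓ) : ⁅X, Y⁆.cD = 2 * (X.cC * Y.cH - X.cH * Y.cC) := rfl
@[simp] theorem cH_lie (X Y : CGA 𝕜 ℓ) : ⁅X, Y⁆.cH = X.cD * Y.cH - X.cH * Y.cD := rfl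
@[simp] theorem cC_lie (X Y : CGA 𝕜 ℓ) : ⁅X, Y⁆.cC = X.cC * Y.cD - X.cD * Y.cC := rfl

theorem cP_of_le (X : CGA 𝕜 ℓ) {n : ℕ} (hn : 2 * ℓ + 1 ≤ n) : X.cP n = 0 := by
  simp [cP, Nat.not_lt.mpr hn]

theorem actP_of_le (X Y : CGA 𝕜 ℓ) {n : ℕ} (hn : 2 * ℓ + 1 ≤ n) : actP X Y n = 0 := by
  obtain _ | n := n
  · omega
  · simp only [actP, cP_of_le Y hn, cP_of_le Y (n := n + 2) (by omega)]
    rcases Nat.lt_or_ge n (2 * ℓ + 1) with h | h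
    · obtain rfl : n = 2 * ℓ := by omega
      push_cast
      ring
    · simp [cP_of_le Y h]

@[simp] theorem cP_lie (X Y : CGA 𝕜 ℓ) (n : ℕ) : ⁅X, Y⁆.cP n = actP X Y n - actP Y X n := by
  rcases Nat.lt_or_ge n (2 * ℓ + 1) with h | h
  · simp only [cP, h, dif_pos]
    rfl
  · simp [cP_of_le _ h, actP_of_le _ _ h]

instance : LieRing (CGA 𝕜 ℓ) where
  add_lie X Y Z := by
    ext1
    · simp; ring
    · simp; ring
    · simp; ring
    · rename_i n _
      obtain _ | n := n <;> simp [actP] <;> ring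
  lie_add X Y Z := by
    ext1
    · simp; ring
    · simp; ring
    · simp; ring
    · rename_i n _
      obtain _ | n := n <;> simp [actP] <;> ring
  lie_self X := by
    ext1
    · simp; ring
    · simp; ring
    · simp; ring
    · simp
  leibniz_lie X Y Z := by
    ext1
    · simp; ring
    · simp; ring
    · simp; ring
    · rename_i n _
      obtain _ | _ | n := n <;> simp [actP] <;> ring

instance : LieAlgebra 𝕜 (CGA 𝕜 ℓ) where
  lie_smul a X Y := by
    ext1
    · simp; ring
    · simp; ring
    · simp; ring
    · rename_i n _
      obtain _ | n := n <;> simp [actP] <;> ring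

variable (𝕜 ℓ)

/-- The generator `D`. -/
def D : CGA 𝕜 ℓ := mk 1 0 0 0

/-- The generator `H`. -/
def H : CGA 𝕜 ℓ := mk 0 1 0 0

/-- The generator `C`. -/
def C : CGA 𝕜 ℓ := mk 0 0 1 0

/-- The generator `P_n`, `0 ≤ n ≤ 2ℓ`. -/
def P (n : ℕ) : CGA 𝕜 ℓ := mk 0 0 0 (Pi.single n 1)

/-- The subspace `𝔤_ℓ⁻`, spanned by `C, P_{ℓ+1}, …, P_{2ℓ}`. -/
def gMinus : Submodule 𝕜 (CGA 𝕜 ℓ) :=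
  Submodule.span 𝕜 ({C 𝕜 ℓ} ∪ {X | ∃ n, ℓ + 1 ≤ n ∧ n ≤ 2 * ℓ ∧ X = P 𝕜 ℓ n})

variable {𝕜 ℓ}

/-! ## The group generated by `𝔤_ℓ` -/

/-- The operator `ad X : Y ↦ [X, Y]`. -/
def adL (X : CGA 𝕜 ℓ) : CGA 𝕜 ℓ →L[𝕜] CGA 𝕜 ℓ :=
  LinearMap.toContinuousLinearMap (LieAlgebra.ad 𝕜 (CGA 𝕜 ℓ) X)

theorem exp_mul_exp_neg (A : CGA 𝕜 ℓ →L[𝕜] CGA 𝕜 ℓ) :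
    NormedSpace.exp A * NormedSpace.exp (-A) = 1 := by
  let : NormedAlgebra ℚ (CGA 𝕜 ℓ →L[𝕜] CGA 𝕜 ℓ) := NormedAlgebra.restrictScalars ℚ 𝕜 _
  rw [← NormedSpace.exp_add_of_commute (Commute.neg_right (Commute.refl A)), add_neg_cancel,
    NormedSpace.exp_zero]

/-- The automorphism `exp (ad X)` of `𝔤_ℓ`. -/
def expAd (X : CGA 𝕜 ℓ) : (CGA 𝕜 ℓ →L[𝕜] CGA 𝕜 ℓ)ˣ where
  val := NormedSpace.exp (adL X)
  inv := NormedSpace.exp (-adL X)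
  val_inv := exp_mul_exp_neg (adL X)
  inv_val := by simpa using exp_mul_exp_neg (-adL X)

variable (𝕜 ℓ)

/-- The group `G` generated by `𝔤_ℓ`: the group generated by all exponentials `exp (ad X)`,
`X ∈ 𝔤_ℓ`, with the topology of the space of linear endomorphisms of `𝔤_ℓ`.
(For `ℓ ≥ 1` the centre of `𝔤_ℓ` is zero, so `𝔤_ℓ` is the Lie algebra of `G`.) -/
def Grp : Subgroup (CGA 𝕜 ℓ →L[𝕜] CGA 𝕜 ℓ)ˣ := Subgroup.closure (Set.range expAd)

variable {𝕜 ℓ}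

/-- The exponential map `𝔤_ℓ → G`. -/
def gexp (X : CGA 𝕜 ℓ) : Grp 𝕜 ℓ := ⟨expAd X, Subgroup.subset_closure ⟨X, rfl⟩⟩

variable (𝕜 ℓ)

/-- The subgroup `G₋` generated by `𝔤_ℓ⁻`. -/
def GMinus : Subgroup (Grp 𝕜 ℓ) := Subgroup.closure (gexp '' (gMinus 𝕜 ℓ : Set (CGA 𝕜 ℓ)))

variable {𝕜 ℓ}

/-- The element `exp (t H) exp (∑_{n < ℓ} x_n P_n)` of `G₊` with coordinates `(t, x)`. -/
def nPlus (w : 𝕜 × (Fin ℓ → 𝕜)) : Grp 𝕜 ℓ :=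
  gexp (w.1 • H 𝕜 ℓ) * gexp (∑ n : Fin ℓ, w.2 n • P 𝕜 ℓ n)

variable (𝕜 ℓ)

/-- The subset `G₊ G₀ G₋` of `G`, where `G₀` consists of the elements `exp (a D + b P_ℓ)`. -/
def bigCell : Set (Grp 𝕜 ℓ) :=
  {g | ∃ (w : 𝕜 × (Fin ℓ → 𝕜)) (a b : 𝕜), ∃ y ∈ GMinus 𝕜 ℓ,
    g = nPlus w * gexp (a • D 𝕜 ℓ + b • P 𝕜 ℓ ℓ) * y}

variable {𝕜 ℓ}

/-! ## Right covariant functions and the two actions -/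

/-- The set `Ω ⊆ G` is open and stable under right multiplication by `G₀ G₋`. -/
structure IsDomain (Ω : Set (Grp 𝕜 ℓ)) : Prop where
  isOpen : IsOpen Ω
  mul_mem : ∀ g ∈ Ω, ∀ a b : 𝕜, ∀ y ∈ GMinus 𝕜 ℓ, g * gexp (a • D 𝕜 ℓ + b • P 𝕜 ℓ ℓ) * y ∈ Ω

/-- Smoothness (`C^∞` if `𝕜 = ℝ`, holomorphy if `𝕜 = ℂ`) of `f : G → ℂ` at all points of `Ω`, in
canonical coordinates `(t, a, c, v) ↦ g exp (t H) exp (a D) exp (c C) exp (∑ n, v_n P_n)` around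
each point `g`. -/
def SmoothOn [NormedAlgebra 𝕜 ℂ] (Ω : Set (Grp 𝕜 ℓ)) (f : Grp 𝕜 ℓ → ℂ) : Prop :=
  ∀ g ∈ Ω, ContDiffAt 𝕜 ∞
    (fun u : 𝕜 × 𝕜 × 𝕜 × (Fin (2 * ℓ + 1) → 𝕜) =>
      f (g * gexp (u.1 • H 𝕜 ℓ) * gexp (u.2.1 • D 𝕜 ℓ) * gexp (u.2.2.1 • C 𝕜 ℓ)
        * gexp (∑ n : Fin (2 * ℓ + 1), u.2.2.2 n • P 𝕜 ℓ n))) 0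

/-- The space `C_Λ` of right covariant smooth functions on the domain `Ω`, for the weight
`Λ(D) = δ`, `Λ(P_ℓ) = p`:  `f (g x y) = e^{Λ(X)} f(g)` for `x = exp X ∈ G₀`, `y ∈ G₋`. -/
structure IsCovariant [NormedAlgebra 𝕜 ℂ] (δ p : ℂ) (Ω : Set (Grp 𝕜 ℓ)) (f : Grp 𝕜 ℓ → ℂ) :
    Prop where
  smooth : SmoothOn Ω f
  covariant : ∀ g ∈ Ω, ∀ a b : 𝕜, ∀ y ∈ GMinus 𝕜 ℓ,
    f (g * gexp (a • D 𝕜 ℓ + b • P 𝕜 ℓ ℓ) * y)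
      = Complex.exp (algebraMap 𝕜 ℂ a * δ + algebraMap 𝕜 ℂ b * p) * f g

/-- The left regular action `(T(g) f)(g') = f(g⁻¹ g')`. -/
def T (g : Grp 𝕜 ℓ) (f : Grp 𝕜 ℓ → ℂ) : Grp 𝕜 ℓ → ℂ := fun g' => f (g⁻¹ * g')

/-- The image `g Ω`: if `f` is given on `Ω`, then `T(g) f` is given on `g Ω`. -/
def translate (g : Grp 𝕜 ℓ) (Ω : Set (Grp 𝕜 ℓ)) : Set (Grp 𝕜 ℓ) := {g' | g⁻¹ * g' ∈ Ω}

/-- The right action `π_R(X) f (g) = d/dτ f(g e^{τ X})` at `τ = 0`. -/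
def piR [NormedAlgebra 𝕜 ℂ] (X : CGA 𝕜 ℓ) (f : Grp 𝕜 ℓ → ℂ) : Grp 𝕜 ℓ → ℂ :=
  fun g => deriv (fun τ : 𝕜 => f (g * gexp (τ • X))) 0

/-- The restriction of a function on `G` to `G₊`, in the coordinates `(t, x)`. -/
def restr (f : Grp 𝕜 ℓ → ℂ) : 𝕜 × (Fin ℓ → 𝕜) → ℂ := fun w => f (nPlus w)

/-- The partial derivative `∂/∂x_n`, `0 ≤ n < ℓ`, of functions of `(t, x_0, …, x_{ℓ-1})`. -/
def pd [NormedAlgebra 𝕜 ℂ] (n : ℕ) (ψ : 𝕜 × (Fin ℓ → 𝕜) → ℂ) : 𝕜 × (Fin ℓ → 𝕜) → ℂ :=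
  fun w => lineDeriv 𝕜 ψ w (0, fun i : Fin ℓ => if (i : ℕ) = n then 1 else 0)

/-- For operators `d 0, d 1, …` on functions on `A`, the operator
`∑_{j=1}^{n-1} (-1)^{n+j} 2 ((ℓ+n)!)² / ((ℓ+j)! (ℓ+2n-j)!) d_{ℓ-2n+j} d_{ℓ-j} + d_{ℓ-n}²`.
All indices are natural numbers if `1 ≤ n` and `2n ≤ ℓ + 1`. -/
def tildeS {A : Type*} (ℓ n : ℕ) (d : ℕ → (A → ℂ) → (A → ℂ)) (ψ : A → ℂ) : A → ℂ := fun w =>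
  ∑ j ∈ Finset.Icc 1 (n - 1),
    ((-1) ^ (n + j) * 2 * ((ℓ + n).factorial : ℂ) ^ 2
      / (((ℓ + j).factorial : ℂ) * ((ℓ + 2 * n - j).factorial : ℂ)))
      * d (ℓ + j - 2 * n) (d (ℓ - j) ψ) w
  + d (ℓ - n) (d (ℓ - n) ψ) w

/-- Let `opG` be an operator `π_R(𝒫)` on functions on `G` and `op` a differential operator on
functions of `(t, x)`. The equation `op ψ = 0` is invariant, in the sense of intertwining operators
from `C_Λ`, `Λ = (δ, p)`, to `C_Λ'`, `Λ' = (δ', p')`. -/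
structure IsInvariantEquation [NormedAlgebra 𝕜 ℂ] (δ p δ' p' : ℂ)
    (opG : (Grp 𝕜 ℓ → ℂ) → (Grp 𝕜 ℓ → ℂ))
    (op : (𝕜 × (Fin ℓ → 𝕜) → ℂ) → (𝕜 × (Fin ℓ → 𝕜) → ℂ)) : Prop where
  /-- On `G₊`, `π_R(𝒫)` is the differential operator `op`. -/
  restr_eq : ∀ Ω, IsDomain Ω → ∀ f, IsCovariant δ p Ω f →
    ∀ w, nPlus w ∈ Ω → op (restr f) w = restr (opG f) w
  /-- `π_R(𝒫)` maps `C_Λ` to `C_Λ'`. -/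
  maps : ∀ Ω, IsDomain Ω → ∀ f, IsCovariant δ p Ω f → IsCovariant δ' p' Ω (opG f)
  /-- `T(g)` maps `C_Λ` to `C_Λ` and `π_R(𝒫) T(g) = T(g) π_R(𝒫)`. -/
  intertwines : ∀ Ω, IsDomain Ω → ∀ f, IsCovariant δ p Ω f → ∀ g,
    IsDomain (translate g Ω) ∧ IsCovariant δ p (translate g Ω) (T g f) ∧
      ∀ g' ∈ translate g Ω, opG (T g f) g' = T g (opG f) g'
  /-- `T(g)` maps solutions on (an open part of) `G₊` to solutions. -/
  solutions : ∀ Ω, IsDomain Ω → Ω ⊆ bigCell 𝕜 ℓ → ∀ f, IsCovariant δ p Ω f →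
    (∀ w, nPlus w ∈ Ω → op (restr f) w = 0) →
    ∀ g w, nPlus w ∈ translate g Ω → op (restr (T g f)) w = 0

end CGA

end

/-! ### Exponentials of bounded operators and conjugation -/

section OperatorExponential

open NormedSpace
open scoped Nat

variable {𝕜 : Type*} [RCLike 𝕜]
  {E : Type*} [NormedAddCommGroup E] [NormedSpace 𝕜 E] [CompleteSpace E]
  {F : Type*} [NormedAddCommGroup F] [NormedSpace 𝕜 F] [CompleteSpace F]

/-! Left and right translations commute, so `π_R(𝒫)` intertwines the `T(g)` automatically. On `G₊`
the factor with the commuting `P_n` stands last, so `π_R(P_n)` is `∂/∂x_n` there (`restr_piR`). The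
real content is that `π_R(𝒫) f` is again covariant; a solution on `G₊` then extends by covariance to
a zero on the part of the big cell in `Ω`, and remains a solution after translation
(`isInvariantEquation_of`).

For covariance, move `exp Y` to the right of the derivative: `π_R(X)` at `g exp Y` becomes `π_R(Ad Y
X)` at `g` (`piR_mul_gexp`). Under `D` the vector `P_{ℓ-j}` has weight `j`, which gives the shift of
`δ`. For `Y` in `𝔤_ℓ⁻` with `C`-coordinate `c`, `Ad Y` sends `P_n` to a binomial sum of the `c^i
P_{n+i}`, and since `p = 0` all `π_R(P_m)` with `m ≥ ℓ` kill `f`. Hence `P_{ℓ-1}` is fixed modulo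
terms killing `f`.

For the quadratic operator put `u_j = P_{ℓ-j} / (ℓ+j)!`. Modulo the same terms, `Ad Y` multiplies
the generating series `∑ u_j z^j` by `exp(cz)`. Up to a constant, `tildeS` is the coefficient of
`z^{2n}` in the product of this series at `-z` and at `z`, where the factors `exp(-cz)` and
`exp(cz)` cancel (`sum_antidiagonal_alternating_shift`). Powers and products follow by composition,
since these results hold for every `δ`. -/

theorem hasSum_exp_smul_pow {A : Type*} [NormedRing A] [NormedAlgebra 𝕜 A] [CompleteSpace A]
    (a : A) : HasSum (fun n : ℕ => ((n ! : 𝕜)⁻¹) • a ^ n) (exp a) := by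
  let : NormedAlgebra ℝ A := NormedAlgebra.restrictScalars ℝ 𝕜 A
  simpa only [inv_natCast_smul_eq ℝ 𝕜] using exp_series_hasSum_exp' (𝕂 := ℝ) a

theorem hasSum_exp_apply (A : E →L[𝕜] E) (v : E) :
    HasSum (fun n : ℕ => ((n ! : 𝕜)⁻¹) • (A ^ n) v) (exp A v) := by
  have h := hasSum_exp_smul_pow (𝕜 := 𝕜) A
  have h' := (ContinuousLinearMap.apply 𝕜 E v).hasSum h
  simpa only [Function.comp_def, map_smul, ContinuousLinearMap.apply_apply] using h'

/-- An intertwining operator also intertwines the exponentials. -/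
theorem map_exp_apply_of_intertwine (S : E →L[𝕜] F) (A : E →L[𝕜] E) (B : F →L[𝕜] F)
    (h : ∀ v, S (A v) = B (S v)) (v : E) : S (exp A v) = exp B (S v) := by
  have hpow : ∀ n : ℕ, ∀ v, S ((A ^ n) v) = (B ^ n) (S v) := by
    intro n
    induction n with
    | zero => intro v; simp
    | succ n ih => intro v; rw [pow_succ, pow_succ, mul_apply_eq_comp, ih, h]; rfl
  have h1 := S.hasSum (hasSum_exp_apply A v)
  refine h1.unique ?_
  simpa only [Function.comp_def, map_smul, hpow] using hasSum_exp_apply B (S v)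

theorem exp_apply_of_eigenvector (A : E →L[𝕜] E) (v : E) (c : 𝕜) (h : A v = c • v) :
    exp A v = exp c • v := by
  have hpow : ∀ n : ℕ, (A ^ n) v = c ^ n • v := by
    intro n
    induction n with
    | zero => simp
    | succ n ih => rw [pow_succ', mul_apply_eq_comp, ih, map_smul, h, smul_smul, pow_succ]
  refine (hasSum_exp_apply A v).unique ?_
  simpa only [hpow, smul_smul, smul_eq_mul] using (hasSum_exp_smul_pow (𝕜 := 𝕜) c).smul_const v

/-- The exponential of the commutator with `a` is the conjugation by `exp a`. -/
theorem exp_mul_sub_flip_apply (A X : E →L[𝕜] E) :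
    exp (ContinuousLinearMap.mul 𝕜 (E →L[𝕜] E) A
      - (ContinuousLinearMap.mul 𝕜 (E →L[𝕜] E)).flip A) X = exp A * X * exp (-A) := by
  let : NormedAlgebra ℚ ((E →L[𝕜] E) →L[𝕜] (E →L[𝕜] E)) := NormedAlgebra.restrictScalars ℚ 𝕜 _
  have hl : ∀ Z : E →L[𝕜] E, exp (ContinuousLinearMap.mul 𝕜 (E →L[𝕜] E) A) Z = exp A * Z := by
    intro Z
    have hp : ∀ n : ℕ, (ContinuousLinearMap.mul 𝕜 (E →L[𝕜] E) A ^ n) Z = A ^ n * Z := by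
      intro n
      induction n with
      | zero => simp
      | succ n ih =>
        rw [pow_succ', mul_apply_eq_comp, ih, ContinuousLinearMap.mul_apply', pow_succ',
          mul_assoc]
    refine (hasSum_exp_apply _ Z).unique ?_
    simpa only [hp, smul_mul_assoc] using (hasSum_exp_smul_pow (𝕜 := 𝕜) A).mul_right Z
  have hr : ∀ Z : E →L[𝕜] E,
      exp (-(ContinuousLinearMap.mul 𝕜 (E →L[𝕜] E)).flip A) Z = Z * exp (-A) := by
    intro Z
    have hp : ∀ n : ℕ, ((-(ContinuousLinearMap.mul 𝕜 (E →L[𝕜] E)).flip A) ^ n) Z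
        = Z * (-A) ^ n := by
      intro n
      induction n with
      | zero => simp
      | succ n ih =>
        rw [pow_succ', mul_apply_eq_comp, ih, pow_succ, ← mul_assoc]
        simp only [neg_apply, ContinuousLinearMap.flip_apply,
          ContinuousLinearMap.mul_apply', mul_neg]
    refine (hasSum_exp_apply _ Z).unique ?_
    simpa only [hp, mul_smul_comm] using (hasSum_exp_smul_pow (𝕜 := 𝕜) (-A)).mul_left Z
  -- Left and right multiplications commute by associativity, so the exponential of their difference
  -- factors.
  have hc : Commute (ContinuousLinearMap.mul 𝕜 (E →L[𝕜] E) A)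
      (-(ContinuousLinearMap.mul 𝕜 (E →L[𝕜] E)).flip A) := by
    ext1 Z
    simp [mul_assoc]
  have he := exp_add_of_commute (𝔸 := (E →L[𝕜] E) →L[𝕜] (E →L[𝕜] E)) hc
  rw [sub_eq_add_neg, he, mul_apply_eq_comp, hr, hl, mul_assoc]

end OperatorExponential

/-! ### The adjoint action and the exponential map of `G` -/

namespace CGA

open Finset

variable {𝕜 : Type*} [RCLike 𝕜] {ℓ : ℕ}

theorem adL_apply (X Y : CGA 𝕜 ℓ) : adL X Y = ⁅X, Y⁆ := rfl

theorem adL_add (X Y : CGA 𝕜 ℓ) : adL (X + Y) = adL X + adL Y := by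
  ext1 Z
  simp [adL_apply]

theorem adL_smul (a : 𝕜) (X : CGA 𝕜 ℓ) : adL (a • X) = a • adL X := by
  ext1 Z
  simp [adL_apply]

/-- The adjoint representation as a continuous linear map. -/
noncomputable def adCLM : CGA 𝕜 ℓ →L[𝕜] CGA 𝕜 ℓ →L[𝕜] CGA 𝕜 ℓ :=
  LinearMap.toContinuousLinearMap
    { toFun := adL, map_add' := adL_add, map_smul' := adL_smul }

theorem adCLM_apply (X : CGA 𝕜 ℓ) : adCLM X = adL X := rfl

theorem continuous_adL : Continuous (adL : CGA 𝕜 ℓ → _) := (adCLM (𝕜 := 𝕜) (ℓ := ℓ)).continuous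

/-- The adjoint action of `exp Y` on the Lie algebra. -/
noncomputable def Ad (Y X : CGA 𝕜 ℓ) : CGA 𝕜 ℓ := NormedSpace.exp (adL Y) X

theorem Ad_smul (Y : CGA 𝕜 ℓ) (a : 𝕜) (X : CGA 𝕜 ℓ) : Ad Y (a • X) = a • Ad Y X := by
  simp [Ad]

/-- By the Jacobi identity `ad` intertwines `ad Y` with the commutator by `ad Y`; exponentiating
turns the commutator into conjugation. -/
theorem exp_adL_mul_adL (Y X : CGA 𝕜 ℓ) :
    NormedSpace.exp (adL Y) * adL X = adL (Ad Y X) * NormedSpace.exp (adL Y) := by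
  have h := map_exp_apply_of_intertwine adCLM (adL Y)
    (ContinuousLinearMap.mul 𝕜 (CGA 𝕜 ℓ →L[𝕜] CGA 𝕜 ℓ) (adL Y)
      - (ContinuousLinearMap.mul 𝕜 (CGA 𝕜 ℓ →L[𝕜] CGA 𝕜 ℓ)).flip (adL Y)) (fun Z => by
        ext1 W
        simp [adCLM_apply, adL_apply]) X
  rw [adCLM_apply, adCLM_apply, exp_mul_sub_flip_apply] at h
  rw [Ad, h, mul_assoc]
  have := exp_mul_exp_neg (-adL Y)
  rw [neg_neg] at this
  rw [this, mul_one]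

theorem gexp_mul_gexp (Y X : CGA 𝕜 ℓ) : gexp Y * gexp X = gexp (Ad Y X) * gexp Y := by
  let : NormedAlgebra ℚ (CGA 𝕜 ℓ →L[𝕜] CGA 𝕜 ℓ) := NormedAlgebra.restrictScalars ℚ 𝕜 _
  have h : SemiconjBy (NormedSpace.exp (adL Y)) (adL X) (adL (Ad Y X)) := exp_adL_mul_adL Y X
  exact Subtype.ext (Units.ext h.exp_right)

theorem gexp_zero : gexp (0 : CGA 𝕜 ℓ) = 1 := by
  refine Subtype.ext (Units.ext ?_)
  have : adL (0 : CGA 𝕜 ℓ) = 0 := by ext1 Z; simp [adL_apply]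
  change NormedSpace.exp (adL (0 : CGA 𝕜 ℓ)) = 1
  rw [this, NormedSpace.exp_zero]

theorem gexp_neg (X : CGA 𝕜 ℓ) : gexp (-X) = (gexp X)⁻¹ := by
  refine Subtype.ext (Units.ext ?_)
  have : adL (-X) = -adL X := by ext1 Z; simp [adL_apply]
  change NormedSpace.exp (adL (-X)) = NormedSpace.exp (-adL X)
  rw [this]

theorem gexp_add {X Y : CGA 𝕜 ℓ} (h : ⁅X, Y⁆ = 0) : gexp (X + Y) = gexp X * gexp Y := by
  let : NormedAlgebra ℚ (CGA 𝕜 ℓ →L[𝕜] CGA 𝕜 ℓ) := NormedAlgebra.restrictScalars ℚ 𝕜 _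
  have hc : Commute (adL X) (adL Y) := by
    ext1 Z
    have := leibniz_lie X Y Z
    simpa [adL_apply, h] using this
  refine Subtype.ext (Units.ext ?_)
  change NormedSpace.exp (adL (X + Y)) = NormedSpace.exp (adL X) * NormedSpace.exp (adL Y)
  rw [adL_add, NormedSpace.exp_add_of_commute hc]

theorem continuous_gexp : Continuous (gexp : CGA 𝕜 ℓ → Grp 𝕜 ℓ) := by
  let : NormedAlgebra ℚ (CGA 𝕜 ℓ →L[𝕜] CGA 𝕜 ℓ) := NormedAlgebra.restrictScalars ℚ 𝕜 _
  refine Continuous.subtype_mk (Units.continuous_iff.2 ⟨?_, ?_⟩) _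
  · exact NormedSpace.exp_continuous.comp continuous_adL
  · exact NormedSpace.exp_continuous.comp continuous_adL.neg

/-! ### The abelian ideal spanned by the `P_n` -/

/-- The inclusion of the span of the `P_n`. -/
noncomputable def incl : (Fin (2 * ℓ + 1) → 𝕜) →ₗ[𝕜] CGA 𝕜 ℓ :=
  Fintype.linearCombination 𝕜 fun n => P 𝕜 ℓ n

theorem incl_apply (v : Fin (2 * ℓ + 1) → 𝕜) : incl v = ∑ n, v n • P 𝕜 ℓ n := rfl

@[simp] theorem cD_P (n : ℕ) : (P 𝕜 ℓ n).cD = 0 := rfl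
@[simp] theorem cH_P (n : ℕ) : (P 𝕜 ℓ n).cH = 0 := rfl
@[simp] theorem cC_P (n : ℕ) : (P 𝕜 ℓ n).cC = 0 := rfl

theorem cP_P (n m : ℕ) :
    (P 𝕜 ℓ n).cP m = if m < 2 * ℓ + 1 then (if m = n then 1 else 0) else 0 := by
  unfold cP
  split_ifs <;> simp [P, mk, *]

theorem P_eq_zero {n : ℕ} (hn : 2 * ℓ < n) : P 𝕜 ℓ n = 0 := by
  ext1 <;> try simp
  rename_i m hm
  rw [cP_P, if_pos hm, if_neg (by omega)]

theorem actP_of_zero {X : CGA 𝕜 ℓ} (hD : X.cD = 0) (hH : X.cH = 0) (hC : X.cC = 0)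
    (Y : CGA 𝕜 ℓ) (n : ℕ) : actP X Y n = 0 := by
  obtain _ | n := n <;> simp [actP, hD, hH, hC]

theorem lie_eq_zero_of_coord {X Y : CGA 𝕜 ℓ} (hD : X.cD = 0) (hH : X.cH = 0) (hC : X.cC = 0)
    (hD' : Y.cD = 0) (hH' : Y.cH = 0) (hC' : Y.cC = 0) : ⁅X, Y⁆ = 0 := by
  ext1 <;> simp [hD, hH, hC, hD', hH', hC', actP_of_zero]

@[simp] theorem cD_incl (v : Fin (2 * ℓ + 1) → 𝕜) : (incl v).cD = 0 := by
  have : ∀ s : Finset (Fin (2 * ℓ + 1)), (∑ n ∈ s, v n • P 𝕜 ℓ n).cD = 0 := fun s =>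
    Finset.sum_induction _ (fun X : CGA 𝕜 ℓ => X.cD = 0) (by simp +contextual) rfl (by simp)
  exact this _

@[simp] theorem cH_incl (v : Fin (2 * ℓ + 1) → 𝕜) : (incl v).cH = 0 := by
  have : ∀ s : Finset (Fin (2 * ℓ + 1)), (∑ n ∈ s, v n • P 𝕜 ℓ n).cH = 0 := fun s =>
    Finset.sum_induction _ (fun X : CGA 𝕜 ℓ => X.cH = 0) (by simp +contextual) rfl (by simp)
  exact this _

@[simp] theorem cC_incl (v : Fin (2 * ℓ + 1) → 𝕜) : (incl v).cC = 0 := by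
  have : ∀ s : Finset (Fin (2 * ℓ + 1)), (∑ n ∈ s, v n • P 𝕜 ℓ n).cC = 0 := fun s =>
    Finset.sum_induction _ (fun X : CGA 𝕜 ℓ => X.cC = 0) (by simp +contextual) rfl (by simp)
  exact this _

theorem gexp_incl_add (v w : Fin (2 * ℓ + 1) → 𝕜) :
    gexp (incl (v + w) : CGA 𝕜 ℓ) = gexp (incl v) * gexp (incl w) := by
  rw [map_add, gexp_add (lie_eq_zero_of_coord (by simp) (by simp) (by simp) (by simp) (by simp)
    (by simp))]

theorem P_eq_incl (n : ℕ) :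
    P 𝕜 ℓ n = incl (fun i : Fin (2 * ℓ + 1) => if (i : ℕ) = n then 1 else 0) := by
  rw [incl_apply]
  rcases Nat.lt_or_ge n (2 * ℓ + 1) with h | h
  · rw [Finset.sum_eq_single ⟨n, h⟩]
    · simp
    · intro b _ hb
      rw [if_neg (fun h' => hb (Fin.ext h')), zero_smul]
    · simp
  · rw [P_eq_zero (by omega), Finset.sum_eq_zero]
    intro b _
    rw [if_neg (by omega), zero_smul]

/-! ### The adjoint action on the `P_n` -/

/-- If the `D`- and `H`-components of `X` vanish, `ad X` acts on the `P_n` as a multiple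
of `ad C`. -/
theorem lie_P_of_coord {X : CGA 𝕜 ℓ} (hD : X.cD = 0) (hH : X.cH = 0) (n : ℕ) :
    ⁅X, P 𝕜 ℓ n⁆ = (X.cC * ((2 * ℓ - n : ℕ) : 𝕜)) • P 𝕜 ℓ (n + 1) := by
  ext1 <;> try simp [hD, hH]
  rename_i m hm
  rw [actP_of_zero (X := P 𝕜 ℓ n) rfl rfl rfl, sub_zero]
  obtain _ | m := m
  · simp [actP, hD, hH, cP_P]
  · simp only [actP, hD, hH, cP_P, if_pos hm, if_pos (show m < 2 * ℓ + 1 by omega)]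
    by_cases h : m = n
    · subst h
      rw [Nat.cast_sub (by omega)]
      push_cast
      simp
    · simp [h]

theorem lie_P_of_weight {X : CGA 𝕜 ℓ} (hC : X.cC = 0) (hH : X.cH = 0) (n : ℕ) :
    ⁅X, P 𝕜 ℓ n⁆ = (X.cD * (ℓ - n)) • P 𝕜 ℓ n := by
  ext1 <;> try simp [hC, hH]
  rename_i m hm
  rw [actP_of_zero (X := P 𝕜 ℓ n) rfl rfl rfl, sub_zero]
  by_cases h : m = n
  · subst h
    obtain _ | m := m <;> simp [actP, hC, hH, cP_P]
  · obtain _ | m := m <;> simp [actP, hC, hH, cP_P, h]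

theorem Ad_P_of_weight {X : CGA 𝕜 ℓ} (hC : X.cC = 0) (hH : X.cH = 0) (n : ℕ) :
    Ad X (P 𝕜 ℓ n) = NormedSpace.exp (X.cD * (ℓ - n)) • P 𝕜 ℓ n :=
  exp_apply_of_eigenvector _ _ _ (lie_P_of_weight hC hH n)

/-- Iterating `P_m ↦ c (2ℓ - m) P_{m+1}` produces descending factorials, which the exponential
series divides by `i!`. The series stops because the binomials vanish. -/
theorem Ad_P_of_coord {X : CGA 𝕜 ℓ} (hD : X.cD = 0) (hH : X.cH = 0) (n : ℕ) :
    Ad X (P 𝕜 ℓ n) =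
      ∑ i ∈ range (2 * ℓ - n + 1), (X.cC ^ i * ((2 * ℓ - n).choose i : 𝕜)) • P 𝕜 ℓ (n + i) := by
  have hp : ∀ i : ℕ, (adL X ^ i) (P 𝕜 ℓ n)
      = (X.cC ^ i * ((2 * ℓ - n).descFactorial i : 𝕜)) • P 𝕜 ℓ (n + i) := by
    intro i
    induction i with
    | zero => simp
    | succ i ih =>
      rw [pow_succ', mul_apply_eq_comp, ih, map_smul, adL_apply,
        lie_P_of_coord hD hH, smul_smul, Nat.descFactorial_succ, ← Nat.sub_sub, add_assoc]
      congr 1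
      push_cast
      ring
  refine (hasSum_exp_apply _ _).unique ?_
  have key : ∀ i : ℕ, ((Nat.factorial i : 𝕜)⁻¹) • (adL X ^ i) (P 𝕜 ℓ n)
      = (X.cC ^ i * ((2 * ℓ - n).choose i : 𝕜)) • P 𝕜 ℓ (n + i) := by
    intro i
    rw [hp, smul_smul, Nat.descFactorial_eq_factorial_mul_choose]
    congr 1
    have : (Nat.factorial i : 𝕜) ≠ 0 := Nat.cast_ne_zero.2 (Nat.factorial_ne_zero i)
    push_cast
    field_simp
  simp only [key]
  refine hasSum_sum_of_ne_finset_zero fun i hi => ?_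
  rw [Nat.choose_eq_zero_of_lt (by simpa using hi)]
  simp

end CGA
-- Canonical coordinates, domains and covariant functions
namespace CGA

open Finset Filter Topology

variable {𝕜 : Type*} [RCLike 𝕜] {ℓ : ℕ}

/-- The canonical coordinates around `g`. -/
noncomputable def chart (g : Grp 𝕜 ℓ) (u : 𝕜 × 𝕜 × 𝕜 × (Fin (2 * ℓ + 1) → 𝕜)) : Grp 𝕜 ℓ :=
  g * gexp (u.1 • H 𝕜 ℓ) * gexp (u.2.1 • D 𝕜 ℓ) * gexp (u.2.2.1 • C 𝕜 ℓ) * gexp (incl u.2.2.2)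

/-- Since the abelian factor comes last, right translation along the `P_n` is a shift of
coordinates, so `π_R(P_n)` is a derivative in a constant direction throughout the chart. -/
theorem chart_mul_gexp_incl (g : Grp 𝕜 ℓ) (u : 𝕜 × 𝕜 × 𝕜 × (Fin (2 * ℓ + 1) → 𝕜))
    (w : Fin (2 * ℓ + 1) → 𝕜) : chart g u * gexp (incl w) = chart g (u + (0, 0, 0, w)) := by
  simp only [chart, mul_assoc, Prod.fst_add, Prod.snd_add, add_zero, gexp_incl_add]

theorem mul_chart (g g' : Grp 𝕜 ℓ) (u : 𝕜 × 𝕜 × 𝕜 × (Fin (2 * ℓ + 1) → 𝕜)) :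
    g * chart g' u = chart (g * g') u := by
  simp [chart, mul_assoc]

theorem chart_incl (g : Grp 𝕜 ℓ) (v : Fin (2 * ℓ + 1) → 𝕜) :
    chart g (0, 0, 0, v) = g * gexp (incl v) := by
  simp [chart, gexp_zero]

/-- The function `f` on the orbit of `g` under the group generated by the `P_n`. -/
noncomputable def onOrbit (f : Grp 𝕜 ℓ → ℂ) (g : Grp 𝕜 ℓ) (v : Fin (2 * ℓ + 1) → 𝕜) : ℂ :=
  f (g * gexp (incl v))

theorem onOrbit_zero (f : Grp 𝕜 ℓ → ℂ) (g : Grp 𝕜 ℓ) : onOrbit f g 0 = f g := by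
  simp [onOrbit, gexp_zero]

theorem eventually_mul_gexp_mem {Ω : Set (Grp 𝕜 ℓ)} (hΩ : IsOpen Ω) {g : Grp 𝕜 ℓ} (hg : g ∈ Ω)
    (X : CGA 𝕜 ℓ) : ∀ᶠ τ : 𝕜 in 𝓝 0, g * gexp (τ • X) ∈ Ω := by
  have hc : Continuous fun τ : 𝕜 => g * gexp (τ • X) :=
    continuous_const.mul (continuous_gexp.comp (continuous_id.smul continuous_const))
  refine hc.continuousAt.eventually_mem ?_
  simpa [gexp_zero] using hΩ.mem_nhds hg

theorem IsDomain.mul_mem_right {Ω : Set (Grp 𝕜 ℓ)} (hΩ : IsDomain Ω) {g : Grp 𝕜 ℓ} (hg : g ∈ Ω)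
    {y : Grp 𝕜 ℓ} (hy : y ∈ GMinus 𝕜 ℓ) : g * y ∈ Ω := by
  simpa [gexp_zero] using hΩ.mul_mem g hg 0 0 y hy

theorem IsDomain.mul_gexp_mem {Ω : Set (Grp 𝕜 ℓ)} (hΩ : IsDomain Ω) {g : Grp 𝕜 ℓ} (hg : g ∈ Ω)
    (a b : 𝕜) : g * gexp (a • D 𝕜 ℓ + b • P 𝕜 ℓ ℓ) ∈ Ω := by
  simpa using hΩ.mul_mem g hg a b 1 (one_mem _)

theorem gexp_mem_GMinus {Y : CGA 𝕜 ℓ} (hY : Y ∈ gMinus 𝕜 ℓ) : gexp Y ∈ GMinus 𝕜 ℓ :=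
  Subgroup.subset_closure ⟨Y, hY, rfl⟩

theorem gMinus_coord {Y : CGA 𝕜 ℓ} (hY : Y ∈ gMinus 𝕜 ℓ) : Y.cD = 0 ∧ Y.cH = 0 := by
  refine Submodule.span_induction (p := fun Y _ => Y.cD = 0 ∧ Y.cH = 0) ?_ ?_ ?_ ?_ hY
  · rintro X (rfl | ⟨n, -, -, rfl⟩)
    · exact ⟨rfl, rfl⟩
    · exact ⟨rfl, rfl⟩
  · simp
  · rintro X Y - - ⟨h₁, h₂⟩ ⟨h₃, h₄⟩
    simp [h₁, h₂, h₃, h₄]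
  · rintro a X - ⟨h₁, h₂⟩
    simp [h₁, h₂]

theorem Ad_D_P_P (a b : 𝕜) (n : ℕ) : Ad (a • D 𝕜 ℓ + b • P 𝕜 ℓ ℓ) (P 𝕜 ℓ n)
    = NormedSpace.exp (a * (ℓ - n)) • P 𝕜 ℓ n := by
  have hc : (D 𝕜 ℓ).cD = 1 ∧ (D 𝕜 ℓ).cC = 0 ∧ (D 𝕜 ℓ).cH = 0 := ⟨rfl, rfl, rfl⟩
  rw [Ad_P_of_weight (by simp [hc]) (by simp [hc])]
  simp [hc]

theorem IsDomain.translate {Ω : Set (Grp 𝕜 ℓ)} (hΩ : IsDomain Ω) (g : Grp 𝕜 ℓ) :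
    IsDomain (translate g Ω) where
  isOpen := hΩ.isOpen.preimage (continuous_const_mul g⁻¹)
  mul_mem g' hg' a b y hy := by
    have := hΩ.mul_mem _ hg' a b y hy
    simpa only [CGA.translate, Set.mem_ofPred_eq, mul_assoc] using this

variable [NormedAlgebra 𝕜 ℂ]

/-! ### Derivatives in the directions of the `P_n` -/

theorem smoothOn_iff {Ω : Set (Grp 𝕜 ℓ)} {f : Grp 𝕜 ℓ → ℂ} :
    SmoothOn Ω f ↔ ∀ g ∈ Ω, ContDiffAt 𝕜 ∞ (fun u => f (chart g u)) 0 := Iff.rfl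

theorem SmoothOn.add {Ω : Set (Grp 𝕜 ℓ)} {f₁ f₂ : Grp 𝕜 ℓ → ℂ} (h₁ : SmoothOn Ω f₁)
    (h₂ : SmoothOn Ω f₂) : SmoothOn Ω (fun g => f₁ g + f₂ g) :=
  fun g hg => (h₁ g hg).add (h₂ g hg)

theorem SmoothOn.const_mul {Ω : Set (Grp 𝕜 ℓ)} {f : Grp 𝕜 ℓ → ℂ} (h : SmoothOn Ω f) (c : ℂ) :
    SmoothOn Ω (fun g => c * f g) :=
  fun g hg => contDiffAt_const.mul (h g hg)

theorem SmoothOn.sum {ι : Type*} (s : Finset ι) {Ω : Set (Grp 𝕜 ℓ)} {f : ι → Grp 𝕜 ℓ → ℂ}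
    (h : ∀ i ∈ s, SmoothOn Ω (f i)) : SmoothOn Ω (fun g => ∑ i ∈ s, f i g) :=
  fun g hg => ContDiffAt.sum fun i hi => h i hi g hg

theorem SmoothOn.piR_incl {Ω : Set (Grp 𝕜 ℓ)} {f : Grp 𝕜 ℓ → ℂ} (hf : SmoothOn Ω f)
    (w : Fin (2 * ℓ + 1) → 𝕜) : SmoothOn Ω (piR (incl w) f) := by
  rw [smoothOn_iff] at hf ⊢
  intro g hg
  have h := hf g hg
  have h₁ : ContDiffAt 𝕜 ∞
      (fun u => fderiv 𝕜 (fun u => f (chart g u)) u (0, 0, 0, w)) 0 :=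
    (h.fderiv_right (m := ∞) (by simp)).clm_apply contDiffAt_const
  refine h₁.congr_of_eventuallyEq ?_
  have h₂ := (h.of_le (m := 1) (by exact_mod_cast le_top)).eventually (by simp)
  filter_upwards [h₂] with u hu
  rw [← (hu.differentiableAt (by simp)).lineDeriv_eq_fderiv]
  simp only [piR, lineDeriv]
  congr 1
  funext τ
  rw [← map_smul, chart_mul_gexp_incl]
  simp

theorem SmoothOn.contDiffAt_onOrbit {Ω : Set (Grp 𝕜 ℓ)} {f : Grp 𝕜 ℓ → ℂ} (hf : SmoothOn Ω f)
    {g : Grp 𝕜 ℓ} (hg : g ∈ Ω) : ContDiffAt 𝕜 ∞ (onOrbit f g) 0 := by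
  have h := smoothOn_iff.1 hf g hg
  have hc : ContDiffAt 𝕜 ∞ (fun v : Fin (2 * ℓ + 1) → 𝕜 => ((0 : 𝕜), (0 : 𝕜), (0 : 𝕜), v)) 0 :=
    by fun_prop
  have := ContDiffAt.comp (0 : Fin (2 * ℓ + 1) → 𝕜) (by exact h) hc
  simp only [Function.comp_def, chart_incl] at this
  exact this

theorem onOrbit_piR (f : Grp 𝕜 ℓ → ℂ) (g : Grp 𝕜 ℓ) (v w : Fin (2 * ℓ + 1) → 𝕜) :
    onOrbit (piR (incl w) f) g v = lineDeriv 𝕜 (onOrbit f g) v w := by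
  simp only [onOrbit, piR, lineDeriv]
  congr 1
  funext τ
  rw [← map_smul, mul_assoc, ← gexp_incl_add]

theorem SmoothOn.piR_incl_eq {Ω : Set (Grp 𝕜 ℓ)} {f : Grp 𝕜 ℓ → ℂ} (hf : SmoothOn Ω f)
    {g : Grp 𝕜 ℓ} (hg : g ∈ Ω) (w : Fin (2 * ℓ + 1) → 𝕜) :
    piR (incl w) f g = fderiv 𝕜 (onOrbit f g) 0 w := by
  rw [← onOrbit_zero (piR _ _), onOrbit_piR,
    ((hf.contDiffAt_onOrbit hg).differentiableAt (by simp)).lineDeriv_eq_fderiv]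

/-- Writing the iterated derivative as a second Fréchet derivative makes it bilinear and symmetric
in the two directions. -/
theorem SmoothOn.piR_piR_incl_eq {Ω : Set (Grp 𝕜 ℓ)} {f : Grp 𝕜 ℓ → ℂ} (hf : SmoothOn Ω f)
    {g : Grp 𝕜 ℓ} (hg : g ∈ Ω) (w w' : Fin (2 * ℓ + 1) → 𝕜) :
    piR (incl w) (piR (incl w') f) g = fderiv 𝕜 (fderiv 𝕜 (onOrbit f g)) 0 w w' := by
  have h := hf.contDiffAt_onOrbit hg
  rw [(hf.piR_incl w').piR_incl_eq hg]
  have h₁ : onOrbit (piR (incl w') f) g =ᶠ[𝓝 0] fun v => fderiv 𝕜 (onOrbit f g) v w' := by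
    filter_upwards [(h.of_le (m := 1) (by exact_mod_cast le_top)).eventually (by simp)] with v hv
    rw [onOrbit_piR, (hv.differentiableAt (by simp)).lineDeriv_eq_fderiv]
  have h₂ : DifferentiableAt 𝕜 (fderiv 𝕜 (onOrbit f g)) 0 :=
    (h.fderiv_right (m := ∞) (by simp)).differentiableAt (by simp)
  rw [h₁.fderiv_eq, fderiv_clm_apply h₂ (by fun_prop)]
  simp

theorem SmoothOn.piR_piR_comm {Ω : Set (Grp 𝕜 ℓ)} {f : Grp 𝕜 ℓ → ℂ} (hf : SmoothOn Ω f)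
    {g : Grp 𝕜 ℓ} (hg : g ∈ Ω) (a b : ℕ) :
    piR (P 𝕜 ℓ a) (piR (P 𝕜 ℓ b) f) g = piR (P 𝕜 ℓ b) (piR (P 𝕜 ℓ a) f) g := by
  rw [P_eq_incl, P_eq_incl, hf.piR_piR_incl_eq hg, hf.piR_piR_incl_eq hg]
  refine ((hf.contDiffAt_onOrbit hg).isSymmSndFDerivAt ?_).eq _ _
  rw [minSmoothness_of_isRCLikeNormedField]
  exact ENat.LEInfty.out

theorem SmoothOn.piR_P {Ω : Set (Grp 𝕜 ℓ)} {f : Grp 𝕜 ℓ → ℂ} (hf : SmoothOn Ω f) (n : ℕ) :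
    SmoothOn Ω (piR (P 𝕜 ℓ n) f) := by
  rw [P_eq_incl]
  exact hf.piR_incl _

theorem SmoothOn.piR_sum {Ω : Set (Grp 𝕜 ℓ)} {f : Grp 𝕜 ℓ → ℂ} (hf : SmoothOn Ω f)
    {g : Grp 𝕜 ℓ} (hg : g ∈ Ω) {ι : Type*} (s : Finset ι) (α : ι → 𝕜) (a : ι → ℕ) :
    piR (∑ i ∈ s, α i • P 𝕜 ℓ (a i)) f g
      = ∑ i ∈ s, algebraMap 𝕜 ℂ (α i) * piR (P 𝕜 ℓ (a i)) f g := by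
  simp only [P_eq_incl, ← map_smul, ← map_sum, hf.piR_incl_eq hg]
  simp only [map_sum, map_smul]
  simp only [Algebra.smul_def]

theorem SmoothOn.piR_piR_sum {Ω : Set (Grp 𝕜 ℓ)} {f : Grp 𝕜 ℓ → ℂ} (hf : SmoothOn Ω f)
    {g : Grp 𝕜 ℓ} (hg : g ∈ Ω) {ι κ : Type*} (s : Finset ι) (α : ι → 𝕜) (a : ι → ℕ)
    (t : Finset κ) (β : κ → 𝕜) (b : κ → ℕ) :
    piR (∑ i ∈ s, α i • P 𝕜 ℓ (a i)) (piR (∑ j ∈ t, β j • P 𝕜 ℓ (b j)) f) g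
      = ∑ i ∈ s, algebraMap 𝕜 ℂ (α i) * ∑ j ∈ t, algebraMap 𝕜 ℂ (β j) *
          piR (P 𝕜 ℓ (a i)) (piR (P 𝕜 ℓ (b j)) f) g := by
  simp only [P_eq_incl, ← map_smul, ← map_sum, hf.piR_piR_incl_eq hg]
  simp only [map_sum, map_smul, _root_.sum_apply, smul_apply]
  simp only [Algebra.smul_def, Finset.mul_sum]
  rw [Finset.sum_comm]
  refine Finset.sum_congr rfl fun i _ => Finset.sum_congr rfl fun j _ => ?_
  ring

theorem SmoothOn.piR_smul {Ω : Set (Grp 𝕜 ℓ)} {f : Grp 𝕜 ℓ → ℂ} (hf : SmoothOn Ω f)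
    {g : Grp 𝕜 ℓ} (hg : g ∈ Ω) (α : 𝕜) (a : ℕ) :
    piR (α • P 𝕜 ℓ a) f g = algebraMap 𝕜 ℂ α * piR (P 𝕜 ℓ a) f g := by
  simpa using hf.piR_sum hg {()} (fun _ => α) (fun _ => a)

theorem SmoothOn.piR_piR_smul {Ω : Set (Grp 𝕜 ℓ)} {f : Grp 𝕜 ℓ → ℂ} (hf : SmoothOn Ω f)
    {g : Grp 𝕜 ℓ} (hg : g ∈ Ω) (α β : 𝕜) (a b : ℕ) :
    piR (α • P 𝕜 ℓ a) (piR (β • P 𝕜 ℓ b) f) g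
      = algebraMap 𝕜 ℂ α * (algebraMap 𝕜 ℂ β * piR (P 𝕜 ℓ a) (piR (P 𝕜 ℓ b) f) g) := by
  simpa using hf.piR_piR_sum hg {()} (fun _ => α) (fun _ => a) {()} (fun _ => β) (fun _ => b)

/-! ### Right translations and `π_R` -/

theorem piR_eq_zero {Ω : Set (Grp 𝕜 ℓ)} (hΩ : IsOpen Ω) {f : Grp 𝕜 ℓ → ℂ} (hf : ∀ g ∈ Ω, f g = 0)
    (X : CGA 𝕜 ℓ) {g : Grp 𝕜 ℓ} (hg : g ∈ Ω) : piR X f g = 0 := by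
  have h : (fun τ : 𝕜 => f (g * gexp (τ • X))) =ᶠ[𝓝 0] fun _ => 0 := by
    filter_upwards [eventually_mul_gexp_mem hΩ hg X] with τ hτ using hf _ hτ
  rw [piR, h.deriv_eq, deriv_const]

/-- This is `e^Y e^{τX} = e^{τ Ad Y X} e^Y` under the derivative. Two functions are allowed so that
hypothesis and conclusion have the same shape and the lemma can be iterated. -/
theorem piR_mul_gexp {Ω : Set (Grp 𝕜 ℓ)} (hΩ : IsOpen Ω) {F₁ F₂ : Grp 𝕜 ℓ → ℂ} {c : ℂ}
    {Y : CGA 𝕜 ℓ} (h : ∀ g ∈ Ω, F₁ (g * gexp Y) = c * F₂ g) (X : CGA 𝕜 ℓ) :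
    ∀ g ∈ Ω, piR X F₁ (g * gexp Y) = c * piR (Ad Y X) F₂ g := by
  intro g hg
  have he : (fun τ : 𝕜 => F₁ (g * gexp Y * gexp (τ • X)))
      =ᶠ[𝓝 0] fun τ => c * F₂ (g * gexp (τ • Ad Y X)) := by
    filter_upwards [eventually_mul_gexp_mem hΩ hg (Ad Y X)] with τ hτ
    rw [mul_assoc, gexp_mul_gexp, Ad_smul, ← mul_assoc, h _ hτ]
  rw [piR, he.deriv_eq, deriv_const_mul_field]
  rfl

/-! ### Covariant functions -/

theorem IsCovariant.gexp_gMinus {δ p : ℂ} {Ω : Set (Grp 𝕜 ℓ)} {f : Grp 𝕜 ℓ → ℂ}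
    (hf : IsCovariant δ p Ω f) {g : Grp 𝕜 ℓ} (hg : g ∈ Ω) {Y : CGA 𝕜 ℓ} (hY : Y ∈ gMinus 𝕜 ℓ) :
    f (g * gexp Y) = 1 * f g := by
  simpa [gexp_zero] using hf.covariant g hg 0 0 _ (gexp_mem_GMinus hY)

theorem IsCovariant.gexp_D_P {δ : ℂ} {Ω : Set (Grp 𝕜 ℓ)} {f : Grp 𝕜 ℓ → ℂ}
    (hf : IsCovariant δ 0 Ω f) {g : Grp 𝕜 ℓ} (hg : g ∈ Ω) (a b : 𝕜) :
    f (g * gexp (a • D 𝕜 ℓ + b • P 𝕜 ℓ ℓ)) = Complex.exp (algebraMap 𝕜 ℂ a * δ) * f g := by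
  simpa using hf.covariant g hg a b 1 (one_mem _)

/-- Covariance may be checked on the exponentials. -/
theorem isCovariant_of_gexp {δ : ℂ} {Ω : Set (Grp 𝕜 ℓ)} (hΩ : IsDomain Ω) {f : Grp 𝕜 ℓ → ℂ}
    (hs : SmoothOn Ω f) (hY : ∀ g ∈ Ω, ∀ Y ∈ gMinus 𝕜 ℓ, f (g * gexp Y) = f g)
    (hX : ∀ g ∈ Ω, ∀ a b : 𝕜, f (g * gexp (a • D 𝕜 ℓ + b • P 𝕜 ℓ ℓ))
      = Complex.exp (algebraMap 𝕜 ℂ a * δ) * f g) : IsCovariant δ 0 Ω f := by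
  have hy : ∀ y ∈ GMinus 𝕜 ℓ, ∀ g ∈ Ω, f (g * y) = f g := by
    intro y hy
    refine Subgroup.closure_induction (p := fun y _ => ∀ g ∈ Ω, f (g * y) = f g)
      ?_ ?_ ?_ ?_ hy
    · rintro _ ⟨Y, hY', rfl⟩ g hg
      exact hY g hg Y hY'
    · simp
    · intro x y hx _ h₁ h₂ g hg
      rw [← mul_assoc, h₂ _ (hΩ.mul_mem_right hg hx), h₁ g hg]
    · intro x hx h g hg
      rw [← h _ (hΩ.mul_mem_right hg (inv_mem hx)), inv_mul_cancel_right]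
  refine ⟨hs, fun g hg a b y h => ?_⟩
  rw [hy y h _ (hΩ.mul_gexp_mem hg a b), hX g hg]
  simp

/-- The place where `p = 0` is essential: `f` is then constant along `P_ℓ` too, not only along
`𝔤_ℓ⁻`. -/
theorem IsCovariant.piR_P_eq_zero {δ : ℂ} {Ω : Set (Grp 𝕜 ℓ)} {f : Grp 𝕜 ℓ → ℂ}
    (hf : IsCovariant δ 0 Ω f) {n : ℕ} (hn : ℓ ≤ n) {g : Grp 𝕜 ℓ} (hg : g ∈ Ω) :
    piR (P 𝕜 ℓ n) f g = 0 := by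
  have h : ∀ τ : 𝕜, f (g * gexp (τ • P 𝕜 ℓ n)) = f g := by
    intro τ
    rcases hn.eq_or_lt with rfl | hn
    · simpa using hf.gexp_D_P hg 0 τ
    · rcases Nat.lt_or_ge (2 * ℓ) n with h | h
      · simp [P_eq_zero h, gexp_zero]
      · have hP : P 𝕜 ℓ n ∈ gMinus 𝕜 ℓ := Submodule.subset_span (Or.inr ⟨n, hn, h, rfl⟩)
        simpa using hf.gexp_gMinus hg (Submodule.smul_mem _ τ hP)
  simp [piR, h]

theorem IsCovariant.piR_piR_P_eq_zero_right {δ : ℂ} {Ω : Set (Grp 𝕜 ℓ)} (hΩ : IsDomain Ω)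
    {f : Grp 𝕜 ℓ → ℂ} (hf : IsCovariant δ 0 Ω f) {a b : ℕ} (hb : ℓ ≤ b) {g : Grp 𝕜 ℓ}
    (hg : g ∈ Ω) : piR (P 𝕜 ℓ a) (piR (P 𝕜 ℓ b) f) g = 0 :=
  piR_eq_zero hΩ.isOpen (fun _ h => hf.piR_P_eq_zero hb h) _ hg

theorem algebraMap_exp_eq (c : 𝕜) :
    algebraMap 𝕜 ℂ (NormedSpace.exp c) = Complex.exp (algebraMap 𝕜 ℂ c) := by
  let : NormedAlgebra ℚ 𝕜 := NormedAlgebra.restrictScalars ℚ ℝ 𝕜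
  rw [Complex.exp_eq_exp_ℂ]
  exact NormedSpace.map_exp (algebraMap 𝕜 ℂ) (continuous_algebraMap 𝕜 ℂ) c

theorem algebraMap_weight (a : 𝕜) {j : ℕ} (hj : j ≤ ℓ) :
    algebraMap 𝕜 ℂ (NormedSpace.exp (a * ((ℓ : 𝕜) - ((ℓ - j : ℕ) : 𝕜))))
      = Complex.exp (algebraMap 𝕜 ℂ a * j) := by
  rw [algebraMap_exp_eq, Nat.cast_sub hj]
  simp

theorem IsCovariant.piR_P_sub_one {δ : ℂ} {Ω : Set (Grp 𝕜 ℓ)} (hΩ : IsDomain Ω)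
    {f : Grp 𝕜 ℓ → ℂ} (hf : IsCovariant δ 0 Ω f) (hℓ : 1 ≤ ℓ) :
    IsCovariant (δ + 1) 0 Ω (piR (P 𝕜 ℓ (ℓ - 1)) f) := by
  refine isCovariant_of_gexp hΩ (hf.smooth.piR_P _) ?_ ?_
  · intro g hg Y hY
    rw [piR_mul_gexp hΩ.isOpen (fun g hg => hf.gexp_gMinus hg hY) _ g hg,
      Ad_P_of_coord (gMinus_coord hY).1 (gMinus_coord hY).2, hf.smooth.piR_sum hg,
      -- Every term of `Ad Y P_{ℓ-1}` beyond the first has index at least `ℓ` and kills `f`.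
      Finset.sum_eq_single 0]
    · simp
    · intro i _ hi
      rw [hf.piR_P_eq_zero (by omega) hg, mul_zero]
    · simp
  · intro g hg a b
    rw [piR_mul_gexp hΩ.isOpen (fun g hg => hf.gexp_D_P hg a b) _ g hg, Ad_D_P_P,
      hf.smooth.piR_smul hg, algebraMap_weight a hℓ, ← mul_assoc, ← Complex.exp_add]
    push_cast
    ring_nf

end CGA
-- Generating-function identities behind the coefficients of `tildeS`
section BinomialIdentities

open Finset
open scoped Nat

/-- The coefficient of `z^s` in `exp(-cz) exp(cz) = 1`. -/
theorem sum_antidiagonal_alternating_exp (c : ℂ) (s : ℕ) :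
    ∑ y ∈ antidiagonal s, (-1) ^ y.1 * (c ^ y.1 / (y.1 ! : ℂ)) * (c ^ y.2 / (y.2 ! : ℂ))
      = if s = 0 then 1 else 0 := by
  have h := (Commute.all (-c) c).add_pow' s
  rw [neg_add_cancel, zero_pow_eq] at h
  have hs : (s ! : ℂ) ≠ 0 := Nat.cast_ne_zero.2 (Nat.factorial_ne_zero s)
  have h' : ∑ y ∈ antidiagonal s, (-1) ^ y.1 * (c ^ y.1 / (y.1 ! : ℂ)) * (c ^ y.2 / (y.2 ! : ℂ))
      = (if s = 0 then 1 else 0) / (s ! : ℂ) := by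
    rw [h, Finset.sum_div]
    refine Finset.sum_congr rfl fun y hy => ?_
    rw [HasAntidiagonal.mem_antidiagonal] at hy
    have h₁ : (y.1 ! : ℂ) ≠ 0 := Nat.cast_ne_zero.2 (Nat.factorial_ne_zero _)
    have h₂ : (y.2 ! : ℂ) ≠ 0 := Nat.cast_ne_zero.2 (Nat.factorial_ne_zero _)
    rw [nsmul_eq_mul, ← hy, Nat.cast_add_choose, neg_pow c]
    rw [← hy] at hs
    field_simp
  rw [h']
  split_ifs with h0 <;> simp [h0]

/-- The coefficient of `z ^ N` in `W(z, -z)` does not change when `W(x, y)` is multiplied by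
`exp (c (x + y))`. -/
theorem sum_antidiagonal_alternating_shift (c : ℂ) (N : ℕ) (w : ℕ → ℕ → ℂ) :
    ∑ x ∈ antidiagonal N, (-1) ^ x.1 * ∑ y ∈ antidiagonal x.1, ∑ z ∈ antidiagonal x.2,
      c ^ y.1 / (y.1 ! : ℂ) * (c ^ z.1 / (z.1 ! : ℂ)) * w y.2 z.2
    = ∑ x ∈ antidiagonal N, (-1) ^ x.1 * w x.1 x.2 := by
  have h₁ : ∑ x ∈ antidiagonal N, (-1) ^ x.1 * ∑ y ∈ antidiagonal x.1, ∑ z ∈ antidiagonal x.2,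
      c ^ y.1 / (y.1 ! : ℂ) * (c ^ z.1 / (z.1 ! : ℂ)) * w y.2 z.2
      = ∑ x ∈ antidiagonal N, ∑ y ∈ antidiagonal x.1, ∑ z ∈ antidiagonal x.2,
        ((-1) ^ y.1 * (c ^ y.1 / (y.1 ! : ℂ)) * (c ^ y.2 / (y.2 ! : ℂ)))
          * ((-1) ^ z.1 * w z.1 z.2) := by
    simp only [Finset.mul_sum, ← Finset.sum_product']
    simp only [Finset.sum_sigma']
    -- The index change transposes a 2×2 array: splittings of the two parts of `N` become splittings
    -- of the exponential total and the `w` total. It is its own inverse.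
    refine Finset.sum_nbij'
      (fun q => ⟨(q.2.1.1 + q.2.2.1, q.2.1.2 + q.2.2.2), ((q.2.1.1, q.2.2.1), (q.2.1.2, q.2.2.2))⟩)
      (fun q => ⟨(q.2.1.1 + q.2.2.1, q.2.1.2 + q.2.2.2), ((q.2.1.1, q.2.2.1), (q.2.1.2, q.2.2.2))⟩)
      ?_ ?_ ?_ ?_ ?_
    · rintro ⟨⟨a, b⟩, ⟨i, p⟩, ⟨j, q⟩⟩ h
      simp only [mem_sigma, mem_product, HasAntidiagonal.mem_antidiagonal] at h ⊢
      exact ⟨show i + j + (p + q) = N by omega, trivial, trivial⟩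
    · rintro ⟨⟨a, b⟩, ⟨i, p⟩, ⟨j, q⟩⟩ h
      simp only [mem_sigma, mem_product, HasAntidiagonal.mem_antidiagonal] at h ⊢
      exact ⟨show i + j + (p + q) = N by omega, trivial, trivial⟩
    · rintro ⟨⟨a, b⟩, ⟨i, p⟩, ⟨j, q⟩⟩ h
      simp only [mem_sigma, mem_product, HasAntidiagonal.mem_antidiagonal] at h
      obtain ⟨-, rfl, rfl⟩ := h
      rfl
    · rintro ⟨⟨a, b⟩, ⟨i, p⟩, ⟨j, q⟩⟩ h
      simp only [mem_sigma, mem_product, HasAntidiagonal.mem_antidiagonal] at h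
      obtain ⟨-, rfl, rfl⟩ := h
      rfl
    · rintro ⟨⟨a, b⟩, ⟨i, p⟩, ⟨j, q⟩⟩ h
      simp only [mem_sigma, mem_product, HasAntidiagonal.mem_antidiagonal] at h
      obtain ⟨-, rfl, rfl⟩ := h
      simp only [pow_add]
      ring
  rw [h₁]
  simp only [← Finset.mul_sum, ← Finset.sum_mul, sum_antidiagonal_alternating_exp]
  rw [Finset.sum_eq_single (0, N)]
  · simp
  · rintro ⟨a, b⟩ h hne
    rw [HasAntidiagonal.mem_antidiagonal] at h
    have : a ≠ 0 := by
      rintro rfl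
      exact hne (by rw [← h, zero_add])
    simp [this]
  · simp

/-- The defining sum of `tildeS` as the alternating sum over a full antidiagonal. -/
theorem tildeS_coeff_sum_eq {ℓ n : ℕ} (hn : 1 ≤ n) (h2n : 2 * n ≤ ℓ + 1) (β w : ℕ → ℕ → ℂ)
    (hw : ∀ i j, w i j = w j i) (hw0 : ∀ j, w 0 j = 0)
    (hβ : ∀ i j, 1 ≤ i → 1 ≤ j → i + j = 2 * n →
      β (ℓ - i) (ℓ - j) = ((ℓ + i) ! : ℂ) * ((ℓ + j) ! : ℂ) * w i j) :
    ∑ j ∈ Icc 1 (n - 1), ((-1) ^ (n + j) * 2 * ((ℓ + n) ! : ℂ) ^ 2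
        / (((ℓ + j) ! : ℂ) * ((ℓ + 2 * n - j) ! : ℂ))) * β (ℓ + j - 2 * n) (ℓ - j)
      + β (ℓ - n) (ℓ - n)
    = (-1) ^ n * ((ℓ + n) ! : ℂ) ^ 2 * ∑ x ∈ antidiagonal (2 * n), (-1) ^ x.1 * w x.1 x.2 := by
  set G : ℕ → ℂ := fun j => (-1) ^ j * w j (2 * n - j) with hG
  have hsq : ((-1 : ℂ) ^ n) * (-1) ^ n = 1 := by rw [← mul_pow]; simp
  -- Terms `j` and `2n - j` agree, as `w` is symmetric and `2n` is even; this is the factor `2` in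
  -- `tildeS`.
  have hrefl : ∀ j ∈ range n, G (n + 1 + (n - 1 - j)) = G j := by
    intro j hj
    rw [mem_range] at hj
    have h₁ : n + 1 + (n - 1 - j) = 2 * n - j := by omega
    have h₂ : (-1 : ℂ) ^ (2 * n - j) = (-1) ^ j := by
      rw [neg_one_pow_congr]
      rw [Nat.even_sub (by omega)]
      simp
    simp only [hG, h₁, h₂, hw (2 * n - j)]
    rw [Nat.sub_sub_self (by omega)]
  have hsum : ∑ x ∈ antidiagonal (2 * n), (-1) ^ x.1 * w x.1 x.2
      = 2 * ∑ j ∈ range n, G j + G n := by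
    rw [Finset.Nat.sum_antidiagonal_eq_sum_range_succ_mk,
      show (2 * n).succ = n + 1 + n by omega, Finset.sum_range_add, Finset.sum_range_succ]
    change ∑ j ∈ range n, G j + G n + ∑ j ∈ range n, G (n + 1 + j) = _
    rw [← Finset.sum_range_reflect (fun j => G (n + 1 + j)), Finset.sum_congr rfl hrefl]
    ring
  have hIcc : ∑ j ∈ range n, G j = ∑ j ∈ Icc 1 (n - 1), G j := by
    refine (Finset.sum_subset ?_ ?_).symm
    · intro j hj
      rw [mem_Icc] at hj
      rw [mem_range]
      omega
    · intro j hj hj'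
      rw [mem_range] at hj
      rw [mem_Icc] at hj'
      obtain rfl : j = 0 := by omega
      simp [hG, hw0]
  rw [hsum, hIcc, mul_add, Finset.mul_sum, Finset.mul_sum]
  congr 1
  · refine Finset.sum_congr rfl fun j hj => ?_
    rw [mem_Icc] at hj
    have h₁ : ((ℓ + j) ! : ℂ) ≠ 0 := Nat.cast_ne_zero.2 (Nat.factorial_ne_zero _)
    have h₂ : ((ℓ + (2 * n - j)) ! : ℂ) ≠ 0 := Nat.cast_ne_zero.2 (Nat.factorial_ne_zero _)
    rw [show ℓ + j - 2 * n = ℓ - (2 * n - j) by omega,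
      show ℓ + 2 * n - j = ℓ + (2 * n - j) by omega,
      hβ (2 * n - j) j (by omega) (by omega) (by omega), hw (2 * n - j) j, pow_add]
    simp only [hG]
    field_simp
  · rw [hβ n n hn hn (by omega)]
    simp only [hG]
    rw [show 2 * n - n = n by omega]
    linear_combination (-((ℓ + n) ! : ℂ) ^ 2 * w n n) * hsq

/-- The exponential series of the shift `P_m ↦ (2ℓ - m) P_{m+1}`, in the indexing from the middle
and modulo the `P_m` with `m ≥ ℓ`. -/
theorem sum_choose_mul_eq_sum_antidiagonal {ℓ j : ℕ} (hj : j ≤ ℓ) (c : ℂ) (β : ℕ → ℂ)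
    (hβ : ∀ m, ℓ ≤ m → β m = 0) :
    ∑ i ∈ range (2 * ℓ - (ℓ - j) + 1), c ^ i * ((2 * ℓ - (ℓ - j)).choose i : ℂ) * β (ℓ - j + i)
      = ((ℓ + j) ! : ℂ) * ∑ y ∈ antidiagonal j,
        c ^ y.1 / (y.1 ! : ℂ) * (β (ℓ - y.2) / ((ℓ + y.2) ! : ℂ)) := by
  rw [Finset.Nat.sum_antidiagonal_eq_sum_range_succ_mk, Finset.mul_sum]
  symm
  refine Finset.sum_subset_zero_on_sdiff ?_ ?_ ?_
  · intro i hi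
    rw [mem_range] at hi ⊢
    omega
  · intro i hi
    rw [mem_sdiff, mem_range, mem_range] at hi
    -- For `i > j` the index `ℓ - j + i` exceeds `ℓ`, so only the first `j + 1` terms count.
    rw [hβ _ (by omega), mul_zero]
  · intro i hi
    rw [mem_range] at hi
    have h₁ : (i ! : ℂ) ≠ 0 := Nat.cast_ne_zero.2 (Nat.factorial_ne_zero _)
    have h₂ : ((ℓ + (j - i)) ! : ℂ) ≠ 0 := Nat.cast_ne_zero.2 (Nat.factorial_ne_zero _)
    have h₃ : 2 * ℓ - (ℓ - j) = i + (ℓ + (j - i)) := by omega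
    have h₄ : ℓ + j = i + (ℓ + (j - i)) := by omega
    rw [h₃, h₄, Nat.cast_add_choose, show ℓ - j + i = ℓ - (j - i) by omega]
    field_simp

end BinomialIdentities

/-! ### Covariance of the quadratic operator -/

namespace CGA

open Finset
open scoped Nat

variable {𝕜 : Type*} [RCLike 𝕜] {ℓ : ℕ} [NormedAlgebra 𝕜 ℂ]

theorem IsCovariant.tildeS_gMinus {δ : ℂ} {Ω : Set (Grp 𝕜 ℓ)} (hΩ : IsDomain Ω)
    {f : Grp 𝕜 ℓ → ℂ} (hf : IsCovariant δ 0 Ω f) {n : ℕ} (hn : 1 ≤ n) (h2n : 2 * n ≤ ℓ + 1)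
    {g : Grp 𝕜 ℓ} (hg : g ∈ Ω) {Y : CGA 𝕜 ℓ} (hY : Y ∈ gMinus 𝕜 ℓ) :
    tildeS ℓ n (fun m => piR (P 𝕜 ℓ m)) f (g * gexp Y)
      = tildeS ℓ n (fun m => piR (P 𝕜 ℓ m)) f g := by
  obtain ⟨hYD, hYH⟩ := gMinus_coord hY
  set c : ℂ := algebraMap 𝕜 ℂ Y.cC with hc
  set β : ℕ → ℕ → ℂ := fun a b => piR (P 𝕜 ℓ a) (piR (P 𝕜 ℓ b) f) g with hβ
  have hβr : ∀ a b, ℓ ≤ b → β a b = 0 := fun a b hb => hf.piR_piR_P_eq_zero_right hΩ hb hg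
  have hβs : ∀ a b, β a b = β b a := fun a b => hf.smooth.piR_piR_comm hg a b
  have hβl : ∀ a b, ℓ ≤ a → β a b = 0 := fun a b ha => by rw [hβs, hβr _ _ ha]
  -- Normalised second derivatives at `g`, the products `u_i u_j`; `w'` below holds the
  -- corresponding values at `g exp Y`, that is, `w` multiplied by `exp(c(x + y))` as a double
  -- series.
  set w : ℕ → ℕ → ℂ := fun i j => β (ℓ - i) (ℓ - j) / (((ℓ + i) ! : ℂ) * ((ℓ + j) ! : ℂ)) with hw
  have hws : ∀ i j, w i j = w j i := fun i j => by simp only [hw]; rw [hβs, mul_comm]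
  have hw0 : ∀ j, w 0 j = 0 := fun j => by simp [hw, hβl]
  have hfac : ∀ i : ℕ, (i ! : ℂ) ≠ 0 := fun i => Nat.cast_ne_zero.2 (Nat.factorial_ne_zero _)
  set w' : ℕ → ℕ → ℂ := fun i j => ∑ y ∈ antidiagonal i, ∑ z ∈ antidiagonal j,
    c ^ y.1 / (y.1 ! : ℂ) * (c ^ z.1 / (z.1 ! : ℂ)) * w y.2 z.2 with hw'
  have hws' : ∀ i j, w' i j = w' j i := by
    intro i j
    simp only [hw']
    rw [Finset.sum_comm]
    refine Finset.sum_congr rfl fun y _ => Finset.sum_congr rfl fun z _ => ?_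
    rw [hws]
    ring
  have hw0' : ∀ j, w' 0 j = 0 := fun j => by simp [hw', hw0]
  refine (tildeS_coeff_sum_eq hn h2n
    (fun a b => piR (P 𝕜 ℓ a) (piR (P 𝕜 ℓ b) f) (g * gexp Y)) w' hws' hw0' ?_).trans
    (Eq.trans ?_ (tildeS_coeff_sum_eq hn h2n β w hws hw0 ?_).symm)
  · intro i j hi hj hij
    rw [piR_mul_gexp hΩ.isOpen
        (piR_mul_gexp hΩ.isOpen (fun g hg => hf.gexp_gMinus hg hY) _) _ g hg, one_mul,
      Ad_P_of_coord hYD hYH, Ad_P_of_coord hYD hYH, hf.smooth.piR_piR_sum hg]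
    simp only [map_mul, map_pow, map_natCast, ← hc]
    change ∑ p ∈ _, _ * ∑ q ∈ _, _ * β _ _ = _
    simp only [fun a => sum_choose_mul_eq_sum_antidiagonal (show j ≤ ℓ by omega) c (β a) (hβr a)]
    rw [sum_choose_mul_eq_sum_antidiagonal (show i ≤ ℓ by omega) c
      (fun m => ((ℓ + j) ! : ℂ) * ∑ z ∈ antidiagonal j,
        c ^ z.1 / (z.1 ! : ℂ) * (β m (ℓ - z.2) / ((ℓ + z.2) ! : ℂ))) (fun m hm => by simp [hβl m _ hm])]
    simp only [hw', hw, Finset.mul_sum, Finset.sum_div]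
    refine Finset.sum_congr rfl fun y _ => Finset.sum_congr rfl fun z _ => ?_
    have h₁ := hfac y.1
    have h₂ := hfac z.1
    have h₃ := hfac (ℓ + y.2)
    have h₄ := hfac (ℓ + z.2)
    field_simp
  · rw [sum_antidiagonal_alternating_shift]
  · intro i j _ _ _
    have h₁ := hfac (ℓ + i)
    have h₂ := hfac (ℓ + j)
    simp only [hw]
    field_simp

/-- Every monomial of `tildeS` is `P_{ℓ-i} P_{ℓ-j}` with `i + j = 2n`, hence has `D`-weight `2n`. -/
theorem IsCovariant.tildeS_D_P {δ : ℂ} {Ω : Set (Grp 𝕜 ℓ)} (hΩ : IsDomain Ω)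
    {f : Grp 𝕜 ℓ → ℂ} (hf : IsCovariant δ 0 Ω f) {n : ℕ} (hn : 1 ≤ n) (h2n : 2 * n ≤ ℓ + 1)
    {g : Grp 𝕜 ℓ} (hg : g ∈ Ω) (a b : 𝕜) :
    tildeS ℓ n (fun m => piR (P 𝕜 ℓ m)) f (g * gexp (a • D 𝕜 ℓ + b • P 𝕜 ℓ ℓ))
      = Complex.exp (algebraMap 𝕜 ℂ a * (δ + 2 * n))
        * tildeS ℓ n (fun m => piR (P 𝕜 ℓ m)) f g := by
  have key : ∀ i j : ℕ, 1 ≤ i → 1 ≤ j → i + j = 2 * n →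
      piR (P 𝕜 ℓ (ℓ - i)) (piR (P 𝕜 ℓ (ℓ - j)) f) (g * gexp (a • D 𝕜 ℓ + b • P 𝕜 ℓ ℓ))
        = Complex.exp (algebraMap 𝕜 ℂ a * (δ + 2 * n))
          * piR (P 𝕜 ℓ (ℓ - i)) (piR (P 𝕜 ℓ (ℓ - j)) f) g := by
    intro i j hi hj hij
    rw [piR_mul_gexp hΩ.isOpen
        (piR_mul_gexp hΩ.isOpen (fun g hg => hf.gexp_D_P hg a b) _) _ g hg,
      Ad_D_P_P, Ad_D_P_P, hf.smooth.piR_piR_smul hg, algebraMap_weight a (by omega),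
      algebraMap_weight a (by omega), ← mul_assoc, ← mul_assoc, ← Complex.exp_add,
      ← Complex.exp_add]
    have : (i : ℂ) + j = 2 * n := by exact_mod_cast hij
    congr 2
    linear_combination (algebraMap 𝕜 ℂ a) * this
  simp only [tildeS]
  rw [mul_add, Finset.mul_sum, key n n hn hn (by omega)]
  congr 1
  refine Finset.sum_congr rfl fun j hj => ?_
  rw [mem_Icc] at hj
  rw [show ℓ + j - 2 * n = ℓ - (2 * n - j) by omega,
    key (2 * n - j) j (by omega) (by omega) (by omega)]
  ring

theorem IsCovariant.tildeS {δ : ℂ} {Ω : Set (Grp 𝕜 ℓ)} (hΩ : IsDomain Ω)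
    {f : Grp 𝕜 ℓ → ℂ} (hf : IsCovariant δ 0 Ω f) {n : ℕ} (hn : 1 ≤ n) (h2n : 2 * n ≤ ℓ + 1) :
    IsCovariant (δ + 2 * n) 0 Ω (tildeS ℓ n (fun m => piR (P 𝕜 ℓ m)) f) := by
  refine isCovariant_of_gexp hΩ ?_ (fun g hg Y hY => hf.tildeS_gMinus hΩ hn h2n hg hY)
    (fun g hg a b => hf.tildeS_D_P hΩ hn h2n hg a b)
  have hs : ∀ a b, SmoothOn Ω (piR (P 𝕜 ℓ a) (piR (P 𝕜 ℓ b) f)) :=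
    fun a b => (hf.smooth.piR_P b).piR_P a
  exact (SmoothOn.sum _ fun j _ => (hs _ _).const_mul _).add (hs _ _)

/-! ### Restriction to `G₊` and left translations -/

theorem restr_piR (f : Grp 𝕜 ℓ → ℂ) {n : ℕ} (hn : n < ℓ) :
    restr (piR (P 𝕜 ℓ n) f) = pd n (restr f) := by
  funext w
  simp only [restr, piR, pd, lineDeriv]
  congr 1
  funext τ
  have hP : ∑ i : Fin ℓ, (τ • fun i : Fin ℓ => if (i : ℕ) = n then (1 : 𝕜) else 0) i • P 𝕜 ℓ i
      = τ • P 𝕜 ℓ n := by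
    rw [Finset.sum_eq_single ⟨n, hn⟩]
    · simp
    · intro i _ hi
      have : (i : ℕ) ≠ n := fun h => hi (Fin.ext h)
      simp [this]
    · simp
  have hcoord : ∀ v : Fin ℓ → 𝕜, (∑ i : Fin ℓ, v i • P 𝕜 ℓ i).cD = 0 ∧
      (∑ i : Fin ℓ, v i • P 𝕜 ℓ i).cH = 0 ∧ (∑ i : Fin ℓ, v i • P 𝕜 ℓ i).cC = 0 := fun v =>
    Finset.sum_induction _ (fun X : CGA 𝕜 ℓ => X.cD = 0 ∧ X.cH = 0 ∧ X.cC = 0)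
      (by simp +contextual) ⟨rfl, rfl, rfl⟩ (by simp)
  obtain ⟨h₁, h₂, h₃⟩ := hcoord w.2
  simp only [nPlus, Prod.fst_add, Prod.snd_add, Prod.smul_fst, Prod.smul_snd, smul_zero, add_zero,
    Pi.add_apply, add_smul, Finset.sum_add_distrib, hP]
  rw [gexp_add (lie_eq_zero_of_coord h₁ h₂ h₃ (by simp) (by simp) (by simp)), mul_assoc]

theorem restr_tildeS (f : Grp 𝕜 ℓ → ℂ) {n : ℕ} (hn : 1 ≤ n) (h2n : 2 * n ≤ ℓ + 1) :
    restr (CGA.tildeS ℓ n (fun m => piR (P 𝕜 ℓ m)) f) = CGA.tildeS ℓ n pd (restr f) := by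
  funext w
  simp only [CGA.tildeS]
  rw [← restr_piR f (show ℓ - n < ℓ by omega), ← restr_piR _ (show ℓ - n < ℓ by omega)]
  refine congrArg (· + _) (Finset.sum_congr rfl fun j hj => ?_)
  rw [mem_Icc] at hj
  rw [← restr_piR f (show ℓ - j < ℓ by omega), ← restr_piR _ (show ℓ + j - 2 * n < ℓ by omega)]
  rfl

theorem piR_T (X : CGA 𝕜 ℓ) (g : Grp 𝕜 ℓ) (f : Grp 𝕜 ℓ → ℂ) : piR X (T g f) = T g (piR X f) := by
  funext g'
  simp only [piR, T, mul_assoc]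

theorem tildeS_T (n : ℕ) (g : Grp 𝕜 ℓ) (f : Grp 𝕜 ℓ → ℂ) :
    CGA.tildeS ℓ n (fun m => piR (P 𝕜 ℓ m)) (T g f)
      = T g (CGA.tildeS ℓ n (fun m => piR (P 𝕜 ℓ m)) f) := by
  funext g'
  simp only [CGA.tildeS, piR_T]
  rfl

theorem IsCovariant.T {δ p : ℂ} {Ω : Set (Grp 𝕜 ℓ)} {f : Grp 𝕜 ℓ → ℂ}
    (hf : IsCovariant δ p Ω f) (g : Grp 𝕜 ℓ) : IsCovariant δ p (translate g Ω) (T g f) where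
  smooth := by
    rw [smoothOn_iff]
    intro g' hg'
    simpa only [CGA.T, mul_chart] using smoothOn_iff.1 hf.smooth _ hg'
  covariant g' hg' a b y hy := by
    have := hf.covariant _ hg' a b y hy
    simpa only [CGA.T, mul_assoc] using this

/-- For solutions: `opG f` is covariant, so its value at a point of the big cell is a scalar
multiple of its value at the `G₊`-component. -/
theorem isInvariantEquation_of {δ p δ' p' : ℂ} {opG : (Grp 𝕜 ℓ → ℂ) → (Grp 𝕜 ℓ → ℂ)}
    {op : (𝕜 × (Fin ℓ → 𝕜) → ℂ) → (𝕜 × (Fin ℓ → 𝕜) → ℂ)}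
    (hrestr : ∀ f, restr (opG f) = op (restr f)) (hT : ∀ g f, opG (T g f) = T g (opG f))
    (hmaps : ∀ Ω, IsDomain Ω → ∀ f, IsCovariant δ p Ω f → IsCovariant δ' p' Ω (opG f)) :
    IsInvariantEquation δ p δ' p' opG op where
  restr_eq _ _ f _ w _ := by rw [hrestr]
  maps := hmaps
  intertwines Ω hΩ f hf g := ⟨hΩ.translate g, hf.T g, fun g' _ => by rw [hT]⟩
  solutions Ω hΩ hcell f hf hsol g w hw := by
    rw [← hrestr, hT]
    change opG f (g⁻¹ * nPlus w) = 0
    have hw' : g⁻¹ * nPlus w ∈ Ω := hw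
    obtain ⟨v, a, b, y, hy, h⟩ := hcell hw'
    -- The `G₊`-component stays in `Ω`, which is stable under the inverses of the `G₋`- and
    -- `G₀`-factors.
    have hv : nPlus v ∈ Ω := by
      have h₁ := hΩ.mul_gexp_mem (hΩ.mul_mem_right hw' (inv_mem hy)) (-a) (-b)
      have h₂ : (-a) • D 𝕜 ℓ + (-b) • P 𝕜 ℓ ℓ = -(a • D 𝕜 ℓ + b • P 𝕜 ℓ ℓ) := by
        rw [neg_smul, neg_smul, neg_add]
      rwa [h, h₂, gexp_neg, mul_inv_cancel_right, mul_inv_cancel_right] at h₁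
    have h₀ : opG f (nPlus v) = 0 := by
      have := hsol v hv
      rwa [← hrestr] at this
    rw [h, (hmaps Ω hΩ f hf).covariant _ hv a b y hy, h₀, mul_zero]

end CGA

/-! ### Iterates and products of the operators -/

/-- An intertwining relation with a fixed map passes to iterates. -/
theorem iterate_intertwine {A B : Type*} {r : A → B} {F : A → A} {G : B → B}
    (h : ∀ a, r (F a) = G (r a)) (k : ℕ) (a : A) : r (F^[k] a) = G^[k] (r a) :=
  Function.Semiconj.iterate_right (f := r) h k a

theorem proposition7 {𝕜 : Type*} [RCLike 𝕜] [NormedAlgebra 𝕜 ℂ] (ℓ : ℕ) (hℓ : 1 ≤ ℓ)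
    (δ : ℂ) (k : ℕ) (hk : 1 ≤ k) :
    CGA.IsInvariantEquation (𝕜 := 𝕜) (ℓ := ℓ) δ 0 (δ + k) 0
      (CGA.piR (CGA.P 𝕜 ℓ (ℓ - 1)))^[k]
      (CGA.pd (ℓ - 1))^[k] ∧
    (∀ n : ℕ, 1 ≤ n → 2 * n ≤ ℓ + 1 →
      CGA.IsInvariantEquation (𝕜 := 𝕜) (ℓ := ℓ) δ 0 (δ + 2 * n * k) 0
        (CGA.tildeS ℓ n (fun m => CGA.piR (CGA.P 𝕜 ℓ m)))^[k]
        (CGA.tildeS ℓ n CGA.pd)^[k]) ∧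
    (∀ n : ℕ, 1 ≤ n → 2 * n ≤ ℓ + 1 →
      CGA.IsInvariantEquation (𝕜 := 𝕜) (ℓ := ℓ) δ 0 (δ + (2 * n + 1) * k) 0
        (fun f => (CGA.piR (CGA.P 𝕜 ℓ (ℓ - 1)))^[k]
          ((CGA.tildeS ℓ n (fun m => CGA.piR (CGA.P 𝕜 ℓ m)))^[k] f))
        (fun ψ => (CGA.pd (ℓ - 1))^[k] ((CGA.tildeS ℓ n CGA.pd)^[k] ψ))) := by
  -- The weight `δ` is quantified inside because each application changes it.
  have hiter : ∀ (F : (CGA.Grp 𝕜 ℓ → ℂ) → (CGA.Grp 𝕜 ℓ → ℂ)) (c : ℂ) (Ω : Set (CGA.Grp 𝕜 ℓ)),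
      (∀ δ f, CGA.IsCovariant δ 0 Ω f → CGA.IsCovariant (δ + c) 0 Ω (F f)) →
      ∀ (m : ℕ) (δ : ℂ) (f : CGA.Grp 𝕜 ℓ → ℂ), CGA.IsCovariant δ 0 Ω f →
        CGA.IsCovariant (δ + c * m) 0 Ω (F^[m] f) := by
    intro F c Ω hF m
    induction m with
    | zero => intro δ f hf; simpa using hf
    | succ m ih =>
      intro δ f hf
      have := ih _ _ (hF _ _ hf)
      rw [Function.iterate_succ_apply]
      convert this using 1
      push_cast
      ring
  have hP : ∀ (Ω : Set (CGA.Grp 𝕜 ℓ)), CGA.IsDomain Ω → ∀ (δ : ℂ) (f : CGA.Grp 𝕜 ℓ → ℂ),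
      CGA.IsCovariant δ 0 Ω f →
        CGA.IsCovariant (δ + 1 * k) 0 Ω ((CGA.piR (CGA.P 𝕜 ℓ (ℓ - 1)))^[k] f) :=
    fun Ω hΩ => hiter _ 1 Ω (fun _ _ hf => hf.piR_P_sub_one hΩ hℓ) k
  have hS : ∀ n : ℕ, 1 ≤ n → 2 * n ≤ ℓ + 1 → ∀ (Ω : Set (CGA.Grp 𝕜 ℓ)), CGA.IsDomain Ω →
      ∀ (δ : ℂ) (f : CGA.Grp 𝕜 ℓ → ℂ), CGA.IsCovariant δ 0 Ω f →
        CGA.IsCovariant (δ + 2 * n * k) 0 Ω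
          ((CGA.tildeS ℓ n (fun m => CGA.piR (CGA.P 𝕜 ℓ m)))^[k] f) :=
    fun n hn h2n Ω hΩ => hiter _ (2 * n) Ω (fun _ _ hf => hf.tildeS hΩ hn h2n) k
  have hPr := iterate_intertwine
    (fun f : CGA.Grp 𝕜 ℓ → ℂ => CGA.restr_piR f (show ℓ - 1 < ℓ by omega)) k
  have hPT := fun g => iterate_intertwine
    (fun f : CGA.Grp 𝕜 ℓ → ℂ => (CGA.piR_T (CGA.P 𝕜 ℓ (ℓ - 1)) g f).symm) k
  have hSr := fun n hn h2n => iterate_intertwine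
    (fun f : CGA.Grp 𝕜 ℓ → ℂ => CGA.restr_tildeS f (n := n) hn h2n) k
  have hST := fun n g => iterate_intertwine
    (fun f : CGA.Grp 𝕜 ℓ → ℂ => (CGA.tildeS_T n g f).symm) k
  refine ⟨?_, fun n hn h2n => ?_, fun n hn h2n => ?_⟩
  · refine CGA.isInvariantEquation_of hPr (fun g f => (hPT g f).symm) fun Ω hΩ f hf => ?_
    simpa using hP Ω hΩ δ f hf
  · exact CGA.isInvariantEquation_of (hSr n hn h2n) (fun g f => (hST n g f).symm)
      fun Ω hΩ f hf => hS n hn h2n Ω hΩ δ f hf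
  · refine CGA.isInvariantEquation_of (fun f => ?_) (fun g f => ?_) fun Ω hΩ f hf => ?_
    · rw [hPr, hSr n hn h2n]
    · rw [← hST n g, ← hPT g]
    · have := hP Ω hΩ _ _ (hS n hn h2n Ω hΩ δ f hf)
      convert this using 1
      ring
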